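/- Let $K$ be an algebraically closed field of characteristic $2$ and let $X=\{F=0\}\subset\mathbb{P}^3_K$ be a normal quartic surface, i.e. $F$ is homogeneous of degree $4$ and the set $\mathrm{Sing}(X)$ of points where $F$ and all its first partial derivatives vanish is finite. Let $P\in X$ be a double point (a point of multiplicity exactly $2$) such that the projection $\pi_P$ with centre $P$ is a separable double cover of $\mathbb{P}^2$. (In projective coordinates $(x_1,x_2,x_3,z)$ with $P=\{x_1=x_2=x_3=0\}$ one has $$F=z^2Q(x_1,x_2,x_3)+zG(x_1,x_2,x_3)+B(x_1,x_2,x_3),$$ with $Q,G,B$ homogeneous of degrees $2,3,4$ and $Q\neq 0$; separability means that, as a polynomial in $z$ over $K(x_1,x_2,x_3)$, $F$ is separable, i.e. $G\not\equiv 0$.) I) Then $|\mathrm{Sing}(X)|\le 25$. II) Suppose moreover that $P$ is a uniplanar double point, that is, the tangent cone at $P$ is a double plane, and let the coordinates be chosen so that $Q=x_1^2$. (i) If $x_1$ divides $G$, then $|\mathrm{Sing}(X)|\le 17$. (ii) If $G=x_1^2L(x_1,x_2)+x_2x_3N(x_1,x_2)$ with $L,N$ linear forms (possibly zero) in $x_1,x_2$,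 then $|\mathrm{Sing}(X)|\le 19$. (iii) If $G=x_1^2L(x_1,x_2,x_3)+x_1x_2M(x_2,x_3)+x_2^3$ with $L$ a linear form in $x_1,x_2,x_3$ and $M$ a linear form in $x_2,x_3$ (both possibly zero), then $|\mathrm{Sing}(X)|\le 19$. -/

import Mathlib

namespace QuarticSurface

open MvPolynomial

variable {K : Type*} [Field K]

/-- The singular points of the surface `{F = 0}` in projective 3-space over `K`, for `F` homogeneous:
the points at which `F` and all its first partial derivatives vanish. -/
def singularPoints (F : MvPolynomial (Fin 4) K) : Set (Projectivization K (Fin 4 → K)) :=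
  {P | eval P.rep F = 0 ∧ ∀ i, eval P.rep (pderiv i F) = 0}

/-- The Taylor expansion `F (p + x)` of `F` at `p`, as a polynomial in `x`. -/
noncomputable def translate (F : MvPolynomial (Fin 4) K) (p : Fin 4 → K) :
    MvPolynomial (Fin 4) K :=
  aeval (fun i => C (p i) + X i) F

/-- `P` is a point of multiplicity `m` of `{F = 0}`, for `F` homogeneous: the Taylor expansion of `F`
at `P` starts exactly in degree `m`. -/
def HasMultiplicity (F : MvPolynomial (Fin 4) K) (P : Projectivization K (Fin 4 → K)) (m : ℕ) :
    Prop :=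
  (∀ k < m, homogeneousComponent k (translate F P.rep) = 0) ∧
    homogeneousComponent m (translate F P.rep) ≠ 0

/-- The restriction of `F` to the generic line through `p`: the polynomial `F (x + t p)` in `t`,
where `x = (x₀, …, x₃)` is the generic point of `K⁴`, with coordinates in the field of
rational functions `K(x₀, …, x₃)`. Its zeros are the points other than `p` in which that line meets
`{F = 0}`, so it is an equation of the generic fibre of the projection with centre `p`
restricted to `{F = 0}`. -/
noncomputable def genericFibre (F : MvPolynomial (Fin 4) K) (p : Fin 4 → K) :
    Polynomial (FractionRing (MvPolynomial (Fin 4) K)) :=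
  aeval (fun i =>
    Polynomial.C (algebraMap (MvPolynomial (Fin 4) K) (FractionRing (MvPolynomial (Fin 4) K)) (X i)) +
    Polynomial.C (algebraMap K (FractionRing (MvPolynomial (Fin 4) K)) (p i)) * Polynomial.X) F

/-- The projection of `{F = 0}` with centre `P` to the plane of lines through `P` is
(generically) separable. -/
def SeparableProjection (F : MvPolynomial (Fin 4) K) (P : Projectivization K (Fin 4 → K)) : Prop :=
  (genericFibre F P.rep).Separable

/-- The equation `F (A y)` of `{F = 0}` in the new coordinates `y` defined by `x = A y`. -/
noncomputable def changeCoordinates (A : GL (Fin 4) K) (F : MvPolynomial (Fin 4) K) :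
    MvPolynomial (Fin 4) K :=
  aeval (fun i => ∑ j, C ((A : Matrix (Fin 4) (Fin 4) K) i j) * X j) F

/-- In the coordinates `(x₁, x₂, x₃, z)` given by `A` (with indices `0, 1, 2, 3`), the point `P` is
`x₁ = x₂ = x₃ = 0` and the equation of the quartic is `z² Q(x) + z G(x) + B(x)`, with `Q`, `G`, `B`
homogeneous of degrees `2`, `3`, `4` in `x₁, x₂, x₃` (with indices `0, 1, 2`). -/
structure IsTaylorDevelopment (F : MvPolynomial (Fin 4) K) (P : Projectivization K (Fin 4 → K))
    (A : GL (Fin 4) K) (Q G B : MvPolynomial (Fin 3) K) : Prop where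
  centre : P.submodule = Submodule.span K {(A : Matrix (Fin 4) (Fin 4) K).mulVec (Pi.single 3 1)}
  homogeneous_Q : Q.IsHomogeneous 2
  homogeneous_G : G.IsHomogeneous 3
  homogeneous_B : B.IsHomogeneous 4
  equation : changeCoordinates A F =
    X 3 ^ 2 * rename Fin.castSucc Q + X 3 * rename Fin.castSucc G + rename Fin.castSucc B

end QuarticSurface

/-!
Write the quartic as `z² Q + z G + B` with the double point `P` at `x = 0`. In characteristic `2`
the derivative with respect to `z` is `G`, so the singular points other than `P` lie over points
of the plane cubic `G = 0`, and satisfy `z² Q = B` and `z² Qᵢ + z Gᵢ + Bᵢ = 0` for `i = 1, 2, 3`.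
Eliminating `z`, their images `x` in the plane are zeros of the forms `Rᵢ = (∂ᵢ (Q B))² + Q B Gᵢ²`
of degree `10` (`eliminant`). As derivatives of squares vanish, a derivative of `Rᵢ` is `Gᵢ²`
times the same derivative of `Q B`, and at `x` the gradient of `Q B` is proportional to that of
`G`. So the curves `Rᵢ = 0` are tangent to `G = 0` at `x`, and by Bézout a linear combination of
the `Rᵢ` coprime to `G` bounds the number of the points `x` by `3 · 10 / 2 = 15`.

Such a combination exists because an irreducible component of `G = 0` on which all `Rᵢ` vanish
would lift to a curve of singular points; the exception is a component along which `Q` vanishes,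
and that forces `Q` to be a square (`exists_not_dvd_eliminant`). If `Q` is not a square, a line
through `P` contains at most two further singular points, and at most one if `Q ≠ 0` on it, while
`Q = G = B = 0` has at most `8` solutions; the total is at most `1 + 15 + 8 = 24`
(`sum_ncard_le_of_not_sq`). If `Q = ℓ²`, the forms `Rᵢ / ℓ²` of degree `8` and the part of `G`
prime to `ℓ` give at most `12` points with `ℓ ≠ 0`, or `8` if `ℓ ∣ G`, and there are at most `3`,
respectively `4`, points with `ℓ = 0`; each carries one singular point (`sum_ncard_le_of_sq`).
This gives at most `16` singular points for every uniplanar double point, whatever the shape of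
`G`.

Bézout's inequality `two_mul_card_le_of_isRelPrime`, with each point of tangency counted twice, is
obtained by counting dimensions: the forms of large degree `n` in the ideal of two coprime forms
of degrees `d` and `e` have codimension `d e`, and they are killed by the values and the
tangential derivatives at the given points, which are linearly independent functionals.
-/

namespace QuarticSurface

open MvPolynomial

variable {K : Type*} [Field K]

section Bezout

/-! ### Factors of forms -/

/-- The polynomial `f (t x)` in a new variable `t`, which collects the homogeneous components
of `f`. -/
noncomputable def gradingPoly {σ : Type*} (f : MvPolynomial σ K) :
    Polynomial (MvPolynomial σ K) :=
  aeval (fun i => Polynomial.C (X i) * Polynomial.X) f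

lemma coeff_gradingPoly {σ : Type*} (f : MvPolynomial σ K) (k : ℕ) :
    (gradingPoly f).coeff k = homogeneousComponent k f := by
  induction f using MvPolynomial.induction_on' with
  | monomial m c =>
    classical
    have h : gradingPoly (monomial m c) = Polynomial.monomial m.degree (monomial m c) := by
      rw [gradingPoly, aeval_monomial, Finsupp.prod]
      simp only [mul_pow, Finset.prod_mul_distrib, Finset.prod_pow_eq_pow_sum]
      rw [monomial_eq, Finsupp.prod, ← Polynomial.C_mul_X_pow_eq_monomial, Finsupp.degree]
      simp only [map_mul, map_prod, map_pow, mul_assoc]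
      rfl
    rw [h, Polynomial.coeff_monomial]
    ext1 d
    rw [coeff_homogeneousComponent]
    split_ifs with h1 h2 h2
    · rfl
    · rw [coeff_monomial, if_neg]
      rintro rfl
      exact h2 h1
    · rw [coeff_monomial, if_neg, coeff_zero]
      rintro rfl
      exact h1 h2
    · rw [coeff_zero]
  | add p q hp hq =>
    rw [map_add, ← hp, ← hq, ← Polynomial.coeff_add]
    simp [gradingPoly]

lemma isHomogeneous_of_gradingPoly {σ : Type*} {f : MvPolynomial σ K} {n : ℕ}
    (h : ∀ k, (gradingPoly f).coeff k ≠ 0 → k = n) : f.IsHomogeneous n := by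
  have : f = homogeneousComponent n f := by
    conv_lhs => rw [← sum_homogeneousComponent f]
    rw [Finset.sum_eq_single n]
    · intro b _ hb
      by_contra hc
      rw [← coeff_gradingPoly] at hc
      exact hb (h b hc)
    · intro hn
      exact homogeneousComponent_eq_zero _ _ (by simpa using hn)
  rw [this]
  exact homogeneousComponent_isHomogeneous n f

/-- A factor of a nonzero form is a form: `f (t x) g (t x) = t ^ n f (x) g (x)`, and the factors of
a monomial in `t` are monomials. -/
lemma isHomogeneous_of_mul {σ : Type*} {f g : MvPolynomial σ K} {n : ℕ}
    (h : (f * g).IsHomogeneous n) (h0 : f * g ≠ 0) :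
    ∃ a b, a + b = n ∧ f.IsHomogeneous a ∧ g.IsHomogeneous b := by
  have hmul : gradingPoly f * gradingPoly g = Polynomial.monomial n (f * g) := by
    ext1 k
    have h1 : gradingPoly f * gradingPoly g = gradingPoly (f * g) := by simp [gradingPoly]
    rw [h1, coeff_gradingPoly, homogeneousComponent_of_mem h, Polynomial.coeff_monomial]
    simp only [eq_comm]
  have hne : gradingPoly f * gradingPoly g ≠ 0 := by
    rw [hmul]
    simpa using h0
  have hf := left_ne_zero_of_mul hne
  have hg := right_ne_zero_of_mul hne
  have hd := Polynomial.natDegree_mul hf hg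
  have ht := Polynomial.natTrailingDegree_mul hf hg
  rw [hmul, Polynomial.natDegree_monomial_eq _ h0] at hd
  rw [hmul, Polynomial.natTrailingDegree_monomial h0] at ht
  have hf' := Polynomial.natTrailingDegree_le_natDegree (gradingPoly f)
  have hg' := Polynomial.natTrailingDegree_le_natDegree (gradingPoly g)
  refine ⟨(gradingPoly f).natDegree, (gradingPoly g).natDegree, hd.symm, ?_, ?_⟩
  · refine isHomogeneous_of_gradingPoly fun k hk => ?_
    have h1 := Polynomial.le_natDegree_of_ne_zero hk
    have h2 := Polynomial.natTrailingDegree_le_of_ne_zero hk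
    omega
  · refine isHomogeneous_of_gradingPoly fun k hk => ?_
    have h1 := Polynomial.le_natDegree_of_ne_zero hk
    have h2 := Polynomial.natTrailingDegree_le_of_ne_zero hk
    omega

lemma isHomogeneous_quotient {σ : Type*} {f g : MvPolynomial σ K} {a b : ℕ}
    (hf : f.IsHomogeneous a) (hf0 : f ≠ 0) (h : (f * g).IsHomogeneous (a + b)) :
    g.IsHomogeneous b := by
  by_cases hg : g = 0
  · rw [hg]
    exact isHomogeneous_zero _ _ _
  obtain ⟨a', b', hab, ha', hb'⟩ := isHomogeneous_of_mul h (mul_ne_zero hf0 hg)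
  have := ha'.inj_right hf hf0
  obtain rfl : b' = b := by omega
  exact hb'

/-- An irreducible divisor of a nonzero form is a form of positive degree. -/
lemma exists_pos_degree_of_dvd {σ : Type*} {f g : MvPolynomial σ K} {n : ℕ} (hf : Irreducible f)
    (hg : g.IsHomogeneous n) (hg0 : g ≠ 0) (h : f ∣ g) :
    ∃ a, 0 < a ∧ a ≤ n ∧ f.IsHomogeneous a := by
  obtain ⟨k, rfl⟩ := h
  obtain ⟨a, b, hab, ha, -⟩ := isHomogeneous_of_mul hg hg0
  refine ⟨a, Nat.pos_of_ne_zero ?_, by omega, ha⟩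
  rintro rfl
  rw [← totalDegree_zero_iff_isHomogeneous, totalDegree_eq_zero_iff_eq_C] at ha
  refine hf.not_isUnit ?_
  rw [ha, isUnit_map_iff, isUnit_iff_ne_zero]
  intro h0
  rw [h0, map_zero] at ha
  exact hf.ne_zero ha

lemma irreducible_of_isHomogeneous_one {ℓ : MvPolynomial (Fin 3) K} (h : ℓ.IsHomogeneous 1)
    (h0 : ℓ ≠ 0) : Irreducible ℓ := by
  have hunit : ∀ f : MvPolynomial (Fin 3) K, f.IsHomogeneous 0 → f ≠ 0 → IsUnit f := by
    intro f hf hf0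
    rw [← totalDegree_zero_iff_isHomogeneous, totalDegree_eq_zero_iff_eq_C] at hf
    rw [hf] at hf0 ⊢
    rw [isUnit_map_iff, isUnit_iff_ne_zero]
    rintro hc
    exact hf0 (by rw [hc, map_zero])
  refine ⟨fun hu => ?_, fun a b hab => ?_⟩
  · obtain ⟨c, -, hc⟩ := isUnit_iff_eq_C_of_isReduced.mp hu
    rw [hc] at h
    exact absurd ((isHomogeneous_C _ c).inj_right h (by rwa [← hc])) (by norm_num)
  · rw [hab] at h h0
    obtain ⟨m, n, hmn, ha, hb⟩ := isHomogeneous_of_mul h h0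
    rcases Nat.eq_zero_or_pos m with rfl | hm
    · exact Or.inl (hunit a ha (left_ne_zero_of_mul h0))
    · obtain rfl : n = 0 := by omega
      exact Or.inr (hunit b hb (right_ne_zero_of_mul h0))

/-! ### Bézout's inequality in the plane -/

/-- The derivative at `x` in the direction `v`, as a linear form on polynomials. -/
noncomputable def dirDeriv {σ : Type*} [Fintype σ] (x v : σ → K) : MvPolynomial σ K →ₗ[K] K :=
  ∑ j, v j • ((aeval x : MvPolynomial σ K →ₐ[K] K).toLinearMap ∘ₗ (pderiv j).toLinearMap)

lemma dirDeriv_apply {σ : Type*} [Fintype σ] (x v : σ → K) (f : MvPolynomial σ K) :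
    dirDeriv x v f = ∑ j, v j * eval x (pderiv j f) := by
  simp [dirDeriv, aeval_eq_eval]

lemma dirDeriv_mul {σ : Type*} [Fintype σ] (x v : σ → K) (f g : MvPolynomial σ K) :
    dirDeriv x v (f * g) = eval x f * dirDeriv x v g + dirDeriv x v f * eval x g := by
  simp only [dirDeriv_apply, pderiv_mul, map_add, map_mul, Finset.mul_sum, Finset.sum_mul,
    ← Finset.sum_add_distrib]
  exact Finset.sum_congr rfl fun j _ => by ring

lemma pderiv_sq [CharP K 2] {σ : Type*} (i : σ) (f : MvPolynomial σ K) :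
    pderiv i (f ^ 2) = 0 := by
  rw [sq, pderiv_mul, mul_comm]
  exact CharTwo.add_self_eq_zero _

lemma dirDeriv_sq [CharP K 2] {σ : Type*} [Fintype σ] (x v : σ → K) (f : MvPolynomial σ K) :
    dirDeriv x v (f ^ 2) = 0 := by
  rw [sq, dirDeriv_mul, mul_comm]
  exact CharTwo.add_self_eq_zero _

lemma finrank_homogeneousSubmodule (n : ℕ) :
    Module.finrank K (homogeneousSubmodule (Fin 3) K n) = (n + 2).choose 2 := by
  have hs : {d : Fin 3 →₀ ℕ | d.degree = n} =
      (Finset.univ.finsuppAntidiag n : Finset (Fin 3 →₀ ℕ)) := by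
    ext d
    simp [Finsupp.degree_eq_sum]
  have h := Module.finrank_eq_nat_card_basis
    (basisRestrictSupport K {d : Fin 3 →₀ ℕ | d.degree = n})
  rw [homogeneousSubmodule_eq_finsupp_supported]
  refine h.trans ?_
  rw [hs, Nat.card_coe_set_eq, Set.ncard_coe_finset, Finset.card_finsuppAntidiag_nat_eq_choose]
  simp only [Finset.card_univ, Fintype.card_fin]
  rw [show 3 + n - 1 = n + 2 by omega, ← Nat.choose_symm_add]

instance (n : ℕ) : FiniteDimensional K (homogeneousSubmodule (Fin 3) K n) :=
  Module.Finite.iff_fg.mpr (homogeneousSubmodule_fg (Fin 3) K n)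

/-- The linear form with coefficients `c`. -/
noncomputable def linForm {σ : Type*} [Fintype σ] (c : σ → K) : MvPolynomial σ K :=
  ∑ i, C (c i) * X i

lemma linForm_isHomogeneous {σ : Type*} [Fintype σ] (c : σ → K) : (linForm c).IsHomogeneous 1 :=
  IsHomogeneous.sum _ _ _ fun i _ => isHomogeneous_C_mul_X (c i) i

lemma eval_linForm {σ : Type*} [Fintype σ] (c x : σ → K) :
    eval x (linForm c) = ∑ i, c i * x i := by
  simp [linForm]

lemma dirDeriv_linForm {σ : Type*} [Fintype σ] [DecidableEq σ] (c x v : σ → K) :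
    dirDeriv x v (linForm c) = ∑ i, c i * v i := by
  simp only [dirDeriv_apply, linForm, map_sum, pderiv_C_mul, pderiv_X, eval_C,
    Pi.single_apply, apply_ite (eval x), map_zero, mul_ite, mul_one, mul_zero,
    Finset.sum_ite_eq, Finset.mem_univ, if_true]
  exact Finset.sum_congr rfl fun i _ => by simp [mul_comm]

/-- A vector outside a subspace is separated from it by a linear form. -/
lemma exists_linForm {σ : Type*} [Fintype σ] [DecidableEq σ] {W : Submodule K (σ → K)} {y : σ → K}
    (hy : y ∉ W) : ∃ c : σ → K, (∀ x ∈ W, ∑ i, c i * x i = 0) ∧ ∑ i, c i * y i ≠ 0 := by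
  obtain ⟨f, hf, hW⟩ := Submodule.exists_le_ker_of_notMem hy
  have key : ∀ x, ∑ i, f (Pi.single i 1) * x i = f x := fun x => by
    rw [LinearMap.pi_apply_eq_sum_univ f x]
    exact Finset.sum_congr rfl fun i _ => by
      rw [smul_eq_mul, mul_comm]
      congr 2
      ext j
      simp [Pi.single_apply, eq_comm]
  refine ⟨fun i => f (Pi.single i 1), fun x hx => ?_, ?_⟩
  · rw [key]
    exact hW hx
  · rwa [key]

/-- A form of any large degree that vanishes doubly at all but one of a given finite set of points
of the plane. -/
lemma exists_double_vanishing {ι : Type*} [Fintype ι] [DecidableEq ι] (p : ι → Fin 3 → K)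
    (h0 : ∀ i, p i ≠ 0) (hp : ∀ i j, i ≠ j → p i ∉ Submodule.span K {p j}) (i : ι) {n : ℕ}
    (hn : 2 * Fintype.card ι ≤ n) :
    ∃ f : MvPolynomial (Fin 3) K, f.IsHomogeneous n ∧ eval (p i) f ≠ 0 ∧
      ∀ j, j ≠ i → eval (p j) f = 0 ∧ ∀ v, dirDeriv (p j) v f = 0 := by
  have h1 : ∀ j, ∃ c : Fin 3 → K, (j ≠ i → eval (p j) (linForm c) = 0) ∧
      eval (p i) (linForm c) ≠ 0 := fun j => by
    by_cases hj : j = i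
    · obtain ⟨c, -, hc⟩ := exists_linForm (W := ⊥) (y := p i) (by simpa using h0 i)
      exact ⟨c, fun h => absurd hj h, by rwa [eval_linForm]⟩
    · obtain ⟨c, hc, hc'⟩ := exists_linForm (hp i j (Ne.symm hj))
      refine ⟨c, fun _ => ?_, by rwa [eval_linForm]⟩
      rw [eval_linForm]
      exact hc _ (Submodule.mem_span_singleton_self _)
  choose c hc hci using h1
  set P : MvPolynomial (Fin 3) K := ∏ j, linForm (c j) with hP
  have hPh : P.IsHomogeneous (Fintype.card ι) := by
    have := IsHomogeneous.prod Finset.univ (fun j => linForm (c j)) (fun _ => 1)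
      fun j _ => linForm_isHomogeneous (c j)
    simpa using this
  have hPi : eval (p i) P ≠ 0 := by
    rw [hP, map_prod]
    exact Finset.prod_ne_zero_iff.mpr fun j _ => hci j
  have hPj : ∀ j, j ≠ i → eval (p j) P = 0 := fun j hj => by
    rw [hP, map_prod]
    exact Finset.prod_eq_zero (Finset.mem_univ j) (hc j hj)
  refine ⟨P ^ 2 * linForm (c i) ^ (n - 2 * Fintype.card ι), ?_, ?_, fun j hj => ⟨?_, fun v => ?_⟩⟩
  · have := (hPh.pow 2).mul ((linForm_isHomogeneous (c i)).pow (n - 2 * Fintype.card ι))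
    convert! this using 1
    omega
  · rw [map_mul, map_pow, map_pow]
    exact mul_ne_zero (pow_ne_zero _ hPi) (pow_ne_zero _ (hci i))
  · rw [map_mul, map_pow, hPj j hj]
    simp
  · rw [dirDeriv_mul, sq, dirDeriv_mul, map_mul, hPj j hj]
    simp

/-- The forms of degree `n` in the ideal generated by two coprime forms of degrees `d` and `e` have
codimension at most `d e` in all forms of degree `n`, if `n ≥ d + e`. -/
lemma finrank_le_of_isRelPrime {A R : MvPolynomial (Fin 3) K} {d e : ℕ} (hA : A.IsHomogeneous d)
    (hR : R.IsHomogeneous e) (hA0 : A ≠ 0) (hco : IsRelPrime A R) (k : ℕ)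
    (W : Submodule K (MvPolynomial (Fin 3) K)) [FiniteDimensional K W]
    (hAW : ∀ a ∈ homogeneousSubmodule (Fin 3) K (e + k), a * A ∈ W)
    (hRW : ∀ b ∈ homogeneousSubmodule (Fin 3) K (d + k), b * R ∈ W) :
    (d + e + k + 2).choose 2 ≤ d * e + Module.finrank K W := by
  let μ : homogeneousSubmodule (Fin 3) K (e + k) × homogeneousSubmodule (Fin 3) K (d + k) →ₗ[K]
      MvPolynomial (Fin 3) K :=
    LinearMap.coprod ((LinearMap.mulRight K A).domRestrict _)
      ((LinearMap.mulRight K R).domRestrict _)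
  have hμ : ∀ a b, μ (a, b) = a * A + b * R := fun a b => rfl
  have hμW : LinearMap.range μ ≤ W := by
    rintro _ ⟨⟨a, b⟩, rfl⟩
    exact W.add_mem (hAW a a.2) (hRW b b.2)
  -- The syzygies of two coprime forms are the multiples of the trivial one.
  let κ : homogeneousSubmodule (Fin 3) K k →ₗ[K]
      homogeneousSubmodule (Fin 3) K (e + k) × homogeneousSubmodule (Fin 3) K (d + k) :=
    LinearMap.prod
      (((LinearMap.mulLeft K (-R)).domRestrict _).codRestrict _ fun c => hR.neg.mul c.2)
      (((LinearMap.mulLeft K A).domRestrict _).codRestrict _ fun c => hA.mul c.2)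
  have hκ : LinearMap.ker μ ≤ LinearMap.range κ := by
    rintro ⟨⟨a, ha⟩, ⟨b, hb⟩⟩ hab
    rw [LinearMap.mem_ker, hμ] at hab
    simp only at hab
    have hdvd : A ∣ b * R := ⟨-a, by linear_combination hab⟩
    obtain ⟨c, rfl⟩ := hco.dvd_of_dvd_mul_right hdvd
    have hc : c.IsHomogeneous k := isHomogeneous_quotient hA hA0 hb
    refine ⟨⟨c, hc⟩, ?_⟩
    have ha' : a = -R * c := by
      apply mul_right_cancel₀ hA0
      linear_combination hab
    exact Prod.ext (Subtype.ext ha'.symm) rfl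
  have h1 := LinearMap.finrank_range_add_finrank_ker μ
  rw [Module.finrank_prod, finrank_homogeneousSubmodule, finrank_homogeneousSubmodule] at h1
  have h2 := (Submodule.finrank_mono hκ).trans (LinearMap.finrank_range_le κ)
  rw [finrank_homogeneousSubmodule] at h2
  have h3 := Submodule.finrank_mono hμW
  have hch : (d + e + k + 2).choose 2 + (k + 2).choose 2 =
      d * e + (e + k + 2).choose 2 + (d + k + 2).choose 2 := by
    have h (m : ℕ) : ((m + 2).choose 2 : ℚ) = (m + 2) * (m + 1) / 2 := by
      rw [Nat.cast_choose_two]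
      push_cast
      ring
    have : (((d + e + k + 2).choose 2 + (k + 2).choose 2 : ℕ) : ℚ) =
      ((d * e + (e + k + 2).choose 2 + (d + k + 2).choose 2 : ℕ) : ℚ) := by
      push_cast [h]
      ring
    exact_mod_cast this
  omega

/-- Bézout's inequality for two plane curves without common component, at points where both have a
common tangent direction, so that each counts twice. -/
theorem two_mul_card_le_of_isRelPrime {A R : MvPolynomial (Fin 3) K} {d e : ℕ}
    (hA : A.IsHomogeneous d) (hR : R.IsHomogeneous e) (hA0 : A ≠ 0) (hco : IsRelPrime A R)
    {ι : Type*} [Fintype ι] (p v : ι → Fin 3 → K) (h0 : ∀ i, p i ≠ 0)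
    (hp : ∀ i j, i ≠ j → p i ∉ Submodule.span K {p j})
    (hv : ∀ i, v i ∉ Submodule.span K {p i})
    (hpA : ∀ i, eval (p i) A = 0) (hpR : ∀ i, eval (p i) R = 0)
    (hvA : ∀ i, dirDeriv (p i) (v i) A = 0) (hvR : ∀ i, dirDeriv (p i) (v i) R = 0) :
    2 * Fintype.card ι ≤ d * e := by
  classical
  set k := 2 * Fintype.card ι + 1 with hk
  set V := homogeneousSubmodule (Fin 3) K (d + e + k) with hV
  -- The values and the directional derivatives at the given points.
  let Λ : ι ⊕ ι → Module.Dual K V := Sum.elim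
    (fun i => ((aeval (p i) : MvPolynomial (Fin 3) K →ₐ[K] K).toLinearMap).domRestrict V)
    (fun i => (dirDeriv (p i) (v i)).domRestrict V)
  have hΛl : ∀ i f, Λ (Sum.inl i) f = eval (p i) f.1 := fun i f => by
    simp [Λ, aeval_eq_eval]
  have hΛr : ∀ i f, Λ (Sum.inr i) f = dirDeriv (p i) (v i) f.1 := fun i f => rfl
  have hind : LinearIndependent K Λ := by
    rw [Fintype.linearIndependent_iff]
    intro g hg
    have hg' : ∀ f : V, ∑ i, (g (Sum.inl i) * eval (p i) f.1 +
        g (Sum.inr i) * dirDeriv (p i) (v i) f.1) = 0 := fun f => by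
      have := LinearMap.congr_fun hg f
      simp only [Fintype.sum_sum_type, LinearMap.add_apply, LinearMap.sum_apply,
        LinearMap.smul_apply, hΛl, hΛr, smul_eq_mul, LinearMap.zero_apply] at this
      rw [Finset.sum_add_distrib, this]
    have hkey : ∀ i, g (Sum.inr i) = 0 ∧ g (Sum.inl i) = 0 := fun i => by
      obtain ⟨f, hf, hfi, hfj⟩ := exists_double_vanishing p h0 hp i
        (n := d + e + 2 * Fintype.card ι) (by omega)
      have hsum : ∀ c : Fin 3 → K, g (Sum.inl i) * eval (p i) (f * linForm c) +
          g (Sum.inr i) * dirDeriv (p i) (v i) (f * linForm c) = 0 := fun c => by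
        have h := hg' ⟨f * linForm c, by
          have := hf.mul (linForm_isHomogeneous c)
          exact this⟩
        rw [Finset.sum_eq_single i] at h
        · exact h
        · intro j _ hj
          simp [dirDeriv_mul, hfj j hj]
        · simp
      have hr : g (Sum.inr i) = 0 := by
        obtain ⟨c, hc, hc'⟩ := exists_linForm (hv i)
        have h := hsum c
        rw [map_mul, dirDeriv_mul, dirDeriv_linForm, eval_linForm,
          hc _ (Submodule.mem_span_singleton_self _)] at h
        simpa [hfi, hc'] using h
      refine ⟨hr, ?_⟩
      obtain ⟨c, -, hc⟩ := exists_linForm (W := ⊥) (y := p i) (by simpa using h0 i)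
      have h := hsum c
      rw [hr, map_mul, eval_linForm] at h
      simpa [hfi, hc] using h
    rintro (i | i)
    · exact (hkey i).2
    · exact (hkey i).1
  let W : Submodule K V := Submodule.dualCoannihilator (Submodule.span K (Set.range Λ))
  have hW : ∀ f : V, (∀ i, eval (p i) f.1 = 0) → (∀ i, dirDeriv (p i) (v i) f.1 = 0) → f ∈ W := by
    intro f h1 h2
    rw [Submodule.mem_dualCoannihilator]
    intro φ hφ
    induction hφ using Submodule.span_induction with
    | mem x hx =>
      obtain ⟨s | s, rfl⟩ := hx
      · rw [hΛl, h1]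
      · rw [hΛr, h2]
    | zero => rfl
    | add x y _ _ hx hy => rw [LinearMap.add_apply, hx, hy, add_zero]
    | smul a x _ hx => rw [LinearMap.smul_apply, hx, smul_zero]
  have h1 := Subspace.finrank_add_finrank_dualCoannihilator_eq (Submodule.span K (Set.range Λ))
  rw [finrank_span_eq_card hind, Fintype.card_sum,
    show Module.finrank K V = (d + e + k + 2).choose 2 from finrank_homogeneousSubmodule _] at h1
  have h2 := finrank_le_of_isRelPrime hA hR hA0 hco k (W.map V.subtype) ?_ ?_
  · rw [Submodule.finrank_map_subtype_eq] at h2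
    change _ + Module.finrank K W = _ at h1
    omega
  · intro a ha
    refine ⟨⟨a * A, ?_⟩, hW _ (fun i => ?_) (fun i => ?_), rfl⟩
    · have := IsHomogeneous.mul ha hA
      rw [hV, mem_homogeneousSubmodule]
      convert! this using 1
      omega
    · simp [hpA]
    · simp [dirDeriv_mul, hpA, hvA]
  · intro a ha
    refine ⟨⟨a * R, ?_⟩, hW _ (fun i => ?_) (fun i => ?_), rfl⟩
    · have := IsHomogeneous.mul ha hR
      rw [hV, mem_homogeneousSubmodule]
      convert! this using 1
      omega
    · simp [hpR]
    · simp [dirDeriv_mul, hpR, hvR]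

end Bezout

section PlaneCurves

/-! ### Zeros of plane curves -/

lemma eval_smul_of_isHomogeneous {σ : Type*} {f : MvPolynomial σ K} {n : ℕ}
    (hf : f.IsHomogeneous n) (t : K) (x : σ → K) : eval (t • x) f = t ^ n * eval x f := by
  rw [eval_eq, eval_eq, Finset.mul_sum]
  refine Finset.sum_congr rfl fun m hm => ?_
  rw [hf.degree_eq_sum_deg_support hm]
  simp only [Pi.smul_apply, smul_eq_mul, mul_pow, Finset.prod_mul_distrib,
    Finset.prod_pow_eq_pow_sum]
  ring

lemma rep_notMem_span {V : Type*} [AddCommGroup V] [Module K V] {x y : Projectivization K V}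
    (h : x ≠ y) : x.rep ∉ Submodule.span K {y.rep} := by
  intro hm
  obtain ⟨a, ha⟩ := Submodule.mem_span_singleton.mp hm
  apply h
  rw [← x.mk_rep, ← y.mk_rep, Projectivization.mk_eq_mk_iff']
  exact ⟨a, ha⟩

lemma finrank_span_pair_le {V : Type*} [AddCommGroup V] [Module K V] (x y : V) :
    Module.finrank K (Submodule.span K {x, y}) ≤ 2 := by
  classical
  have h := finrank_span_finset_le_card (R := K) ({x, y} : Finset V)
  rw [Finset.coe_pair] at h
  exact h.trans Finset.card_le_two

/-- Each point of a plane curve has a tangent direction. -/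
lemma exists_dirDeriv_eq_zero (x : Fin 3 → K) (f : MvPolynomial (Fin 3) K) :
    ∃ v, v ∉ Submodule.span K {x} ∧ dirDeriv x v f = 0 := by
  let φ : (Fin 3 → K) →ₗ[K] K := ∑ j, eval x (pderiv j f) • LinearMap.proj j
  have hφ : ∀ v, φ v = dirDeriv x v f := fun v => by
    simp [φ, dirDeriv_apply, mul_comm]
  by_contra! h
  have hle : LinearMap.ker φ ≤ Submodule.span K {x} := fun v hv => by
    by_contra hv'
    exact h v hv' (by rwa [← hφ])
  have h1 := Submodule.finrank_mono hle
  have h2 : Module.finrank K (Submodule.span K {x}) ≤ 1 := by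
    have h := finrank_span_finset_le_card (R := K) ({x} : Finset (Fin 3 → K))
    rwa [Finset.coe_singleton, Finset.card_singleton] at h
  have h3 := LinearMap.finrank_range_add_finrank_ker φ
  have h4 := Submodule.finrank_le (LinearMap.range φ)
  rw [Module.finrank_self] at h4
  simp only [Module.finrank_fintype_fun_eq_card, Fintype.card_fin] at h3
  omega

lemma two_mul_card_finset_le {A R : MvPolynomial (Fin 3) K} {d e : ℕ}
    (hA : A.IsHomogeneous d) (hR : R.IsHomogeneous e) (hA0 : A ≠ 0) (hco : IsRelPrime A R)
    (S : Finset (Projectivization K (Fin 3 → K)))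
    (hS : ∀ x ∈ S, eval x.rep A = 0 ∧ eval x.rep R = 0 ∧ ∃ v, v ∉ Submodule.span K {x.rep} ∧
      dirDeriv x.rep v A = 0 ∧ dirDeriv x.rep v R = 0) :
    2 * S.card ≤ d * e := by
  choose! h1 h2 v hv h3 h4 using hS
  have := two_mul_card_le_of_isRelPrime hA hR hA0 hco (ι := S) (fun x => x.1.rep) (fun x => v x.1)
    (fun x => x.1.rep_nonzero) (fun x y hxy => rep_notMem_span fun h => hxy (Subtype.ext h))
    (fun x => hv x.1 x.2) (fun x => h1 x.1 x.2) (fun x => h2 x.1 x.2) (fun x => h3 x.1 x.2)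
    (fun x => h4 x.1 x.2)
  simpa using this

/-- Bézout's inequality for two plane curves without common component. In characteristic `2` it
follows from the version with tangent directions, applied to `A ^ 2` and `R`, because
`A ^ 2` has all directional derivatives zero. -/
lemma card_finset_le [CharP K 2] {A R : MvPolynomial (Fin 3) K} {d e : ℕ}
    (hA : A.IsHomogeneous d) (hR : R.IsHomogeneous e) (hA0 : A ≠ 0) (hco : IsRelPrime A R)
    (S : Finset (Projectivization K (Fin 3 → K)))
    (hS : ∀ x ∈ S, eval x.rep A = 0 ∧ eval x.rep R = 0) : S.card ≤ d * e := by
  have := two_mul_card_finset_le (hA.pow 2) hR (pow_ne_zero 2 hA0) (hco.pow_left) S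
    fun x hx => ⟨by simp [(hS x hx).1], (hS x hx).2, by
      obtain ⟨v, hv, hv'⟩ := exists_dirDeriv_eq_zero x.rep R
      exact ⟨v, hv, dirDeriv_sq _ _ _, hv'⟩⟩
  nlinarith

variable [IsAlgClosed K]

/-- A form of positive degree has a zero on each affine line `u + t v`, unless its point at infinity
`v` is a zero. -/
lemma exists_zero_on_line {σ : Type*} {f : MvPolynomial σ K} {n : ℕ} (hf : f.IsHomogeneous n)
    (hn : 0 < n) {v : σ → K} (hv : eval v f ≠ 0) (u : σ → K) : ∃ t : K, eval (u + t • v) f = 0 := by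
  -- The restriction of `f` to the line through `a` and `b`.
  let q (a b : σ → K) : Polynomial K :=
    aeval (fun i => Polynomial.C (a i) + Polynomial.C (b i) * Polynomial.X) f
  have hq : ∀ a b t, (q a b).eval t = eval (a + t • b) f := fun a b t => by
    have h := (hom_eval₂ f Polynomial.C (Polynomial.evalRingHom t)
      fun i => Polynomial.C (a i) + Polynomial.C (b i) * Polynomial.X)
    have hC : (Polynomial.evalRingHom t).comp Polynomial.C = RingHom.id K := by
      ext
      simp
    rw [hC] at h
    refine h.trans ?_
    rw [eval, coe_eval₂Hom]
    congr 1
    funext i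
    rw [Polynomial.coe_evalRingHom, Polynomial.eval_add, Polynomial.eval_mul,
      Polynomial.eval_C, Polynomial.eval_C, Polynomial.eval_X, mul_comm]
    rfl
  by_contra! h
  have hdeg : (q u v).degree = 0 := by
    by_contra hd
    obtain ⟨t, ht⟩ := IsAlgClosed.exists_root _ hd
    exact h t (by rw [← hq]; exact ht)
  obtain ⟨c, hc⟩ : ∃ c, q u v = Polynomial.C c := ⟨_, Polynomial.eq_C_of_degree_eq_zero hdeg⟩
  have hr : q v u = Polynomial.C c * Polynomial.X ^ n := by
    refine Polynomial.eq_of_infinite_eval_eq _ _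
      ((Set.finite_singleton (0 : K)).infinite_compl.mono fun s hs => ?_)
    have hs : s ≠ 0 := hs
    have h1 : v + s • u = s • (u + s⁻¹ • v) := by
      rw [smul_add, smul_smul, mul_inv_cancel₀ hs, one_smul, add_comm]
    change (q v u).eval s = (Polynomial.C c * Polynomial.X ^ n).eval s
    rw [hq, h1, eval_smul_of_isHomogeneous hf, ← hq, hc, Polynomial.eval_C, Polynomial.eval_mul,
      Polynomial.eval_C, Polynomial.eval_pow, Polynomial.eval_X, mul_comm]
  apply hv
  have h2 := hq v u 0
  rw [hr, zero_smul, add_zero] at h2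
  rw [← h2]
  simp [hn.ne']

/-- A plane curve has infinitely many points. -/
lemma infinite_zeros {C : MvPolynomial (Fin 3) K} {n : ℕ} (hC : C.IsHomogeneous n) (hn : 0 < n)
    (hC0 : C ≠ 0) : {x : Projectivization K (Fin 3 → K) | eval x.rep C = 0}.Infinite := by
  have : Infinite K := IsAlgClosed.instInfinite
  intro hfin
  obtain ⟨u, hu⟩ : ∃ u, eval u C ≠ 0 := by
    by_contra! h
    exact hC0 (hC.eq_zero_of_forall_eval_eq_zero h)
  -- The lines through `u` and the finitely many zeros do not cover the plane.
  have hlt : ∀ y : Fin 3 → K, Submodule.span K {u, y} ≠ ⊤ := fun y hy => by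
    have h1 := finrank_span_pair_le (K := K) u y
    rw [hy, finrank_top, Module.finrank_fintype_fun_eq_card, Fintype.card_fin] at h1
    omega
  let Z := {x : Projectivization K (Fin 3 → K) | eval x.rep C = 0}
  have : Finite Z := hfin.to_subtype
  obtain ⟨w, hw⟩ : ∃ w : Fin 3 → K, ∀ o : Option Z,
      w ∉ Submodule.span K {u, o.elim u fun x => x.1.rep} := by
    by_contra! h
    obtain ⟨x, hx⟩ := Subspace.exists_eq_top_of_iUnion_eq_univ (k := K)
      (p := fun o : Option Z => Submodule.span K {u, o.elim u fun x => x.1.rep})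
      (Set.eq_univ_of_forall fun w => Set.mem_iUnion.mpr (h w))
    exact hlt _ hx
  obtain ⟨t, ht⟩ := exists_zero_on_line hC hn hu w
  have h0 : w + t • u ≠ 0 := by
    intro h0
    refine hw none ?_
    rw [eq_neg_of_add_eq_zero_left h0]
    exact Submodule.neg_mem _ (Submodule.smul_mem _ _ (Submodule.subset_span (by simp)))
  let x := Projectivization.mk K (w + t • u) h0
  obtain ⟨a, ha⟩ := Projectivization.exists_smul_eq_mk_rep K (w + t • u) h0
  have hx : eval x.rep C = 0 := by
    rw [← ha, Units.smul_def, eval_smul_of_isHomogeneous hC, ht, mul_zero]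
  refine hw (some ⟨x, hx⟩) ?_
  have h1 : w = (a⁻¹ : Kˣ) • x.rep - t • u := by
    rw [← ha, smul_smul, inv_mul_cancel, one_smul, add_sub_cancel_right]
  rw [h1]
  exact Submodule.sub_mem _ (Submodule.smul_mem _ _ (Submodule.subset_span (by simp)))
    (Submodule.smul_mem _ _ (Submodule.subset_span (by simp)))

/-- A line meets every plane curve. -/
lemma exists_common_zero {C D : MvPolynomial (Fin 3) K} {m : ℕ} (hC : C.IsHomogeneous 1)
    (hC0 : C ≠ 0) (hD : D.IsHomogeneous m) (hm : 0 < m) :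
    ∃ x : Fin 3 → K, x ≠ 0 ∧ eval x C = 0 ∧ eval x D = 0 := by
  have hinf := infinite_zeros hC one_pos hC0
  obtain ⟨v, hv⟩ := hinf.nonempty
  obtain ⟨u, hu, huv⟩ := (hinf.sdiff (Set.finite_singleton v)).nonempty
  by_cases hvD : eval v.rep D = 0
  · exact ⟨v.rep, v.rep_nonzero, hv, hvD⟩
  obtain ⟨t, ht⟩ := exists_zero_on_line hD hm hvD u.rep
  refine ⟨u.rep + t • v.rep, fun h => rep_notMem_span huv ?_, ?_, ht⟩
  · rw [eq_neg_of_add_eq_zero_left h]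
    exact Submodule.neg_mem _ (Submodule.smul_mem _ _ (Submodule.mem_span_singleton_self _))
  · obtain ⟨c, rfl⟩ : ∃ c, C = linForm c := by
      rw [← mem_homogeneousSubmodule, homogeneousSubmodule_one_eq_span_X,
        Submodule.mem_span_range_iff_exists_fun] at hC
      obtain ⟨c, hc⟩ := hC
      exact ⟨c, by rw [← hc, linForm]; simp [smul_eq_C_mul]⟩
    change eval u.rep _ = 0 at hu
    change eval v.rep _ = 0 at hv
    rw [eval_linForm] at hu hv ⊢
    simp only [Pi.add_apply, Pi.smul_apply, smul_eq_mul, mul_add, Finset.sum_add_distrib, hu,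
      mul_left_comm _ t, ← Finset.mul_sum, hv]
    simp

/-- If no irreducible factor of `A` divides all the `R i`, then some linear combination of the
`R i` is coprime to `A`: each irreducible factor excludes a proper subspace of coefficients. -/
lemma exists_isRelPrime_combination {ι : Type*} [Fintype ι] {A : MvPolynomial (Fin 3) K}
    (hA : A ≠ 0) (R : ι → MvPolynomial (Fin 3) K)
    (h : ∀ C, Irreducible C → C ∣ A → ∃ i, ¬ C ∣ R i) :
    ∃ c : ι → K, IsRelPrime A (∑ i, C (c i) * R i) := by
  classical
  have : Infinite K := IsAlgClosed.instInfinite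
  let W (D : MvPolynomial (Fin 3) K) : Submodule K (ι → K) :=
    { carrier := {c | D ∣ ∑ i, C (c i) * R i}
      add_mem' := fun {a b} ha hb => by
        change D ∣ ∑ i, C (a i + b i) * R i
        simp only [map_add, add_mul, Finset.sum_add_distrib]
        exact dvd_add ha hb
      zero_mem' := by
        change D ∣ ∑ i, C 0 * R i
        simp
      smul_mem' := fun t a ha => by
        change D ∣ ∑ i, C (t * a i) * R i
        simp only [map_mul, mul_assoc, ← Finset.mul_sum]
        exact Dvd.dvd.mul_left ha _ }
  let s : Finset (Submodule K (ι → K)) := (UniqueFactorizationMonoid.factors A).toFinset.image W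
  have hs : ⊤ ∉ s := by
    intro ht
    obtain ⟨D, hD, hDt⟩ := Finset.mem_image.mp ht
    rw [Multiset.mem_toFinset] at hD
    obtain ⟨i, hi⟩ := h D (UniqueFactorizationMonoid.irreducible_of_factor D hD)
      (UniqueFactorizationMonoid.dvd_of_mem_factors hD)
    apply hi
    have h1 : Pi.single i 1 ∈ W D := by rw [hDt]; trivial
    have h2 : D ∣ ∑ j, C ((Pi.single i 1 : ι → K) j) * R j := h1
    simpa [Pi.single_apply, apply_ite C] using h2
  obtain ⟨c, hc⟩ := (Set.ne_univ_iff_exists_notMem _).mp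
    (Subspace.biUnion_ne_univ_of_top_notMem hs)
  refine ⟨c, WfDvdMonoid.isRelPrime_of_no_irreducible_factors (fun h0 => hA h0.1) ?_⟩
  intro D hD hDA hDR
  obtain ⟨E, hE, hDE⟩ := UniqueFactorizationMonoid.exists_mem_factors_of_dvd hA hD hDA
  refine hc (Set.mem_iUnion₂.mpr
    ⟨W E, Finset.mem_image_of_mem W (Multiset.mem_toFinset.mpr hE), ?_⟩)
  exact hDE.dvd_iff_dvd_left.mp hDR

variable [CharP K 2]

lemma infinite_zeros_diff {C D : MvPolynomial (Fin 3) K} {n m : ℕ} (hC : C.IsHomogeneous n)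
    (hn : 0 < n) (hCi : Irreducible C) (hD : D.IsHomogeneous m) (hCD : ¬ C ∣ D) :
    {x : Projectivization K (Fin 3 → K) | eval x.rep C = 0 ∧ eval x.rep D ≠ 0}.Infinite := by
  have hfin :
      {x : Projectivization K (Fin 3 → K) | eval x.rep C = 0 ∧ eval x.rep D = 0}.Finite := by
    by_contra hinf
    obtain ⟨S, hS, hcard⟩ := Set.Infinite.exists_subset_card_eq hinf (n * m + 1)
    have := card_finset_le hC hD hCi.ne_zero (hCi.isRelPrime_iff_not_dvd.mpr hCD) S
      fun x hx => hS hx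
    omega
  refine ((infinite_zeros hC hn hCi.ne_zero).sdiff hfin).mono fun x hx => ⟨hx.1, fun h => ?_⟩
  exact hx.2 ⟨hx.1, h⟩

end PlaneCurves

section DoubleCover

/-! ### The double cover and its singular points -/

/-- `(x, z)` is a singular point of `z ^ 2 Q + z G + B = 0`, written out in characteristic `2`: the
equation itself is simplified by means of `G x = 0`. -/
def SingularOver (Q G B : MvPolynomial (Fin 3) K) (x : Fin 3 → K) (z : K) : Prop :=
  eval x G = 0 ∧ z ^ 2 * eval x Q + eval x B = 0 ∧
    ∀ i, z ^ 2 * eval x (pderiv i Q) + z * eval x (pderiv i G) + eval x (pderiv i B) = 0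

lemma SingularOver.dirDeriv_eq_zero {Q G B : MvPolynomial (Fin 3) K} {x : Fin 3 → K} {z : K}
    (h : SingularOver Q G B x z) (v : Fin 3 → K) :
    z ^ 2 * dirDeriv x v Q + z * dirDeriv x v G + dirDeriv x v B = 0 := by
  simp only [dirDeriv_apply, Finset.mul_sum, ← Finset.sum_add_distrib]
  exact Finset.sum_eq_zero fun i _ => by linear_combination v i * h.2.2 i

/-- A common factor `C` of `Q`, `G` and `B` makes every point of `X` over `C = 0` at which the
cofactor vanishes singular. -/
lemma singularOver_of_factor {C Q G B : MvPolynomial (Fin 3) K} {x : Fin 3 → K} {z : K}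
    (hC : eval x C = 0) (h : z ^ 2 * eval x Q + z * eval x G + eval x B = 0) :
    SingularOver (C * Q) (C * G) (C * B) x z := by
  refine ⟨by simp [hC], by simp [hC], fun i => ?_⟩
  simp only [pderiv_mul, map_add, map_mul, hC]
  linear_combination eval x (pderiv i C) * h

/-- A quadratic polynomial with three roots vanishes. -/
lemma quadratic_eq_zero {q g b x y z : K} (hxy : x ≠ y) (hxz : x ≠ z) (hyz : y ≠ z)
    (hx : x ^ 2 * q + x * g + b = 0) (hy : y ^ 2 * q + y * g + b = 0)
    (hz : z ^ 2 * q + z * g + b = 0) : q = 0 ∧ g = 0 ∧ b = 0 := by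
  have h1 : (x + y) * q + g = 0 := by
    apply mul_left_cancel₀ (sub_ne_zero.mpr hxy)
    linear_combination hx - hy
  have h2 : (x + z) * q + g = 0 := by
    apply mul_left_cancel₀ (sub_ne_zero.mpr hxz)
    linear_combination hx - hz
  have hq : q = 0 := by
    apply mul_left_cancel₀ (sub_ne_zero.mpr hyz)
    linear_combination h1 - h2
  subst hq
  have hg : g = 0 := by linear_combination h1
  subst hg
  exact ⟨rfl, rfl, by linear_combination hx⟩

section Eliminants

variable [CharP K 2] {Q G B : MvPolynomial (Fin 3) K}

/-- The polynomials in `x` obtained by eliminating `z` from the equation `z ^ 2 Q + B = 0` and the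
derivative of the equation of the surface with respect to the `i`-th coordinate, up to the equation
`G = 0`. -/
noncomputable def eliminant (Q G B : MvPolynomial (Fin 3) K) (i : Fin 3) : MvPolynomial (Fin 3) K :=
  pderiv i (Q * B) ^ 2 + Q * B * pderiv i G ^ 2

/-- The eliminant for `Q = ℓ ^ 2`, divided by `ℓ ^ 2`. -/
noncomputable def eliminantOfSq (ℓ G B : MvPolynomial (Fin 3) K) (i : Fin 3) :
    MvPolynomial (Fin 3) K :=
  ℓ ^ 2 * pderiv i B ^ 2 + B * pderiv i G ^ 2

lemma SingularOver.eval_eliminant {x : Fin 3 → K} {z : K} (h : SingularOver Q G B x z)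
    (i : Fin 3) : eval x (eliminant Q G B i) = 0 := by
  obtain ⟨h1, h2, h3⟩ := h
  have h0 : (2 : K) = 0 := CharTwo.two_eq_zero
  have hB : eval x B = z ^ 2 * eval x Q := by linear_combination h2 - z ^ 2 * eval x Q * h0
  have hBi : eval x (pderiv i B) = z ^ 2 * eval x (pderiv i Q) + z * eval x (pderiv i G) := by
    linear_combination h3 i - (z ^ 2 * eval x (pderiv i Q) + z * eval x (pderiv i G)) * h0
  simp only [eliminant, pderiv_mul, map_add, map_mul, map_pow, hB, hBi]
  linear_combination (2 * z ^ 4 * eval x (pderiv i Q) ^ 2 * eval x Q ^ 2 +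
    2 * z ^ 3 * eval x (pderiv i Q) * eval x Q ^ 2 * eval x (pderiv i G) +
    z ^ 2 * eval x Q ^ 2 * eval x (pderiv i G) ^ 2) * h0

lemma SingularOver.dirDeriv_eliminant {x v : Fin 3 → K} {z : K} (h : SingularOver Q G B x z)
    (hv : dirDeriv x v G = 0) (i : Fin 3) : dirDeriv x v (eliminant Q G B i) = 0 := by
  have h0 : (2 : K) = 0 := CharTwo.two_eq_zero
  have h1 := h.dirDeriv_eq_zero v
  have h2 := h.2.1
  rw [hv] at h1
  rw [eliminant, map_add, dirDeriv_sq, dirDeriv_mul, dirDeriv_sq, dirDeriv_mul, map_pow]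
  linear_combination eval x (pderiv i G) ^ 2 * (eval x Q * h1 + dirDeriv x v Q * h2 -
    z ^ 2 * eval x Q * dirDeriv x v Q * h0)

lemma SingularOver.mul_pderiv_eq {ℓ : MvPolynomial (Fin 3) K} {x : Fin 3 → K} {z : K}
    (h : SingularOver (ℓ ^ 2) G B x z) (i : Fin 3) :
    eval x (pderiv i B) = z * eval x (pderiv i G) := by
  have h0 : (2 : K) = 0 := CharTwo.two_eq_zero
  have h3 := h.2.2 i
  rw [pderiv_sq, map_zero] at h3
  linear_combination h3 - z * eval x (pderiv i G) * h0

lemma SingularOver.eval_eliminantOfSq {ℓ : MvPolynomial (Fin 3) K} {x : Fin 3 → K} {z : K}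
    (h : SingularOver (ℓ ^ 2) G B x z) (i : Fin 3) : eval x (eliminantOfSq ℓ G B i) = 0 := by
  have h2 := h.2.1
  rw [map_pow] at h2
  simp only [eliminantOfSq, map_add, map_mul, map_pow, h.mul_pderiv_eq]
  linear_combination eval x (pderiv i G) ^ 2 * h2

lemma SingularOver.dirDeriv_eliminantOfSq {ℓ : MvPolynomial (Fin 3) K} {x v : Fin 3 → K} {z : K}
    (h : SingularOver (ℓ ^ 2) G B x z) (hv : dirDeriv x v G = 0) (i : Fin 3) :
    dirDeriv x v (eliminantOfSq ℓ G B i) = 0 := by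
  have h1 := h.dirDeriv_eq_zero v
  rw [hv, dirDeriv_sq] at h1
  rw [eliminantOfSq, map_add, dirDeriv_mul, dirDeriv_sq, dirDeriv_sq, dirDeriv_mul, dirDeriv_sq,
    map_pow (eval x) (pderiv i G)]
  linear_combination eval x (pderiv i G) ^ 2 * h1

lemma ncard_singularOver_le_one {x : Fin 3 → K} (hZ : {z | SingularOver Q G B x z}.Finite)
    (hx : eval x Q ≠ 0) : {z | SingularOver Q G B x z}.ncard ≤ 1 := by
  rw [Set.ncard_le_one hZ]
  intro a ha b hb
  have h : (a - b) ^ 2 * eval x Q = 0 := by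
    rw [sub_pow_char]
    linear_combination ha.2.1 - hb.2.1
  exact sub_eq_zero.mp (pow_eq_zero_iff two_ne_zero |>.mp ((mul_eq_zero.mp h).resolve_right hx))

end Eliminants

variable [IsAlgClosed K]

lemma exists_quadratic_root {q : K} (hq : q ≠ 0) (g b : K) : ∃ z, z ^ 2 * q + z * g + b = 0 := by
  obtain ⟨z, hz⟩ := IsAlgClosed.exists_root
    (Polynomial.C q * Polynomial.X ^ 2 + Polynomial.C g * Polynomial.X + Polynomial.C b)
    (by rw [Polynomial.degree_quadratic hq]; decide)
  refine ⟨z, ?_⟩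
  simp only [Polynomial.IsRoot, Polynomial.eval_add, Polynomial.eval_mul, Polynomial.eval_C,
    Polynomial.eval_pow, Polynomial.eval_X] at hz
  linear_combination hz

/-- If a linear combination of the forms `R i` avoids every component of `A = 0`, Bézout's
inequality bounds the number of common zeros of `A` and the `R i` that have a common tangent
direction. -/
lemma two_mul_card_le_of_family {ι : Type*} [Fintype ι] {A : MvPolynomial (Fin 3) K}
    {R : ι → MvPolynomial (Fin 3) K} {d e : ℕ} (hA : A.IsHomogeneous d)
    (hR : ∀ i, (R i).IsHomogeneous e) (hA0 : A ≠ 0)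
    (h : ∀ C, Irreducible C → C ∣ A → ∃ i, ¬ C ∣ R i)
    (S : Finset (Projectivization K (Fin 3 → K)))
    (hS : ∀ x ∈ S, eval x.rep A = 0 ∧ (∀ i, eval x.rep (R i) = 0) ∧
      ∃ v, v ∉ Submodule.span K {x.rep} ∧ dirDeriv x.rep v A = 0 ∧
        ∀ i, dirDeriv x.rep v (R i) = 0) :
    2 * S.card ≤ d * e := by
  obtain ⟨c, hc⟩ := exists_isRelPrime_combination hA0 R h
  refine two_mul_card_finset_le hA (IsHomogeneous.sum _ _ _ fun i _ => (hR i).C_mul (c i)) hA0 hc S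
    fun x hx => ?_
  obtain ⟨h1, h2, v, hv, h3, h4⟩ := hS x hx
  exact ⟨h1, by simp [h2], v, hv, h3, by simp [← smul_eq_C_mul, h4]⟩

/-- A line through the centre of projection contains at most two further singular points, since
otherwise it consists of singular points. -/
lemma ncard_singularOver_le_two {Q G B : MvPolynomial (Fin 3) K}
    {x : Fin 3 → K} (hZ : {z | SingularOver Q G B x z}.Finite) :
    {z | SingularOver Q G B x z}.ncard ≤ 2 := by
  by_contra! h
  rw [Set.two_lt_ncard_iff hZ] at h
  obtain ⟨a, b, c, ha, hb, hc, hab, hac, hbc⟩ := h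
  have h1 := quadratic_eq_zero (q := eval x Q) (g := 0) (b := eval x B) hab hac hbc
    (by linear_combination ha.2.1) (by linear_combination hb.2.1) (by linear_combination hc.2.1)
  have h2 := fun i => quadratic_eq_zero hab hac hbc (ha.2.2 i) (hb.2.2 i) (hc.2.2 i)
  have : Infinite K := IsAlgClosed.instInfinite
  refine Set.infinite_univ (hZ.subset fun z _ => ⟨ha.1, ?_, fun i => ?_⟩)
  · rw [h1.1, h1.2.2]
    ring
  · rw [(h2 i).1, (h2 i).2.1, (h2 i).2.2]
    ring

variable [CharP K 2]

lemma card_le_of_family {ι : Type*} [Fintype ι] {A : MvPolynomial (Fin 3) K}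
    {R : ι → MvPolynomial (Fin 3) K} {d e : ℕ} (hA : A.IsHomogeneous d)
    (hR : ∀ i, (R i).IsHomogeneous e) (hA0 : A ≠ 0)
    (h : ∀ C, Irreducible C → C ∣ A → ∃ i, ¬ C ∣ R i)
    (S : Finset (Projectivization K (Fin 3 → K)))
    (hS : ∀ x ∈ S, eval x.rep A = 0 ∧ ∀ i, eval x.rep (R i) = 0) :
    S.card ≤ d * e := by
  obtain ⟨c, hc⟩ := exists_isRelPrime_combination hA0 R h
  exact card_finset_le hA (IsHomogeneous.sum _ _ _ fun i _ => (hR i).C_mul (c i)) hA0 hc S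
    fun x hx => ⟨(hS x hx).1, by simp [(hS x hx).2]⟩

/-- A polynomial over a perfect field of characteristic `2` all of whose derivatives vanish is a
square. -/
lemma exists_sq_of_pderiv_eq_zero {σ : Type*} {f : MvPolynomial σ K}
    (h : ∀ i, pderiv i f = 0) : ∃ g, f = g ^ 2 := by
  have heven : ∀ m ∈ f.support, ∃ n, m = n + n := fun m hm => by
    have h1 : ∀ i, ∃ k, m i = k + k := fun i => by
      by_contra hodd
      have hodd' : Odd (m i) := Nat.not_even_iff_odd.mp hodd
      have h2 := coeff_pderiv (i := i) f (m - Finsupp.single i 1 : σ →₀ ℕ)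
      have hle : Finsupp.single i 1 ≤ m := by
        rw [Finsupp.single_le_iff]
        exact hodd'.pos
      rw [h i, coeff_zero, tsub_add_cancel_of_le hle] at h2
      have h3 : (((m - Finsupp.single i 1 : σ →₀ ℕ) i : ℕ) : K) + 1 = 1 := by
        obtain ⟨k, hk⟩ := hodd'
        have : (m - Finsupp.single i 1 : σ →₀ ℕ) i = 2 * k := by
          rw [Finsupp.tsub_apply, hk, Finsupp.single_eq_same, Nat.add_sub_cancel]
        rw [this]
        push_cast
        rw [CharTwo.two_eq_zero]
        ring
      rw [h3, mul_one] at h2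
      exact mem_support_iff.mp hm h2.symm
    choose k hk using h1
    refine ⟨m.mapRange (fun a => a / 2) rfl, ?_⟩
    ext i
    rw [Finsupp.add_apply, Finsupp.mapRange_apply, hk i]
    omega
  choose! n hn using heven
  have hroot : ∀ m, ∃ c, coeff m f = c ^ 2 := fun m => by
    obtain ⟨c, hc⟩ := IsAlgClosed.exists_pow_nat_eq (coeff m f) two_pos
    exact ⟨c, hc.symm⟩
  choose c hc using hroot
  refine ⟨∑ m ∈ f.support, monomial (n m) (c m), ?_⟩
  rw [sum_pow_char 2]
  conv_lhs => rw [f.as_sum]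
  refine Finset.sum_congr rfl fun m hm => ?_
  rw [monomial_pow, ← hc, two_smul, ← hn m hm]

variable {Q G B : MvPolynomial (Fin 3) K}

lemma ncard_singularOver_sq_le_one {ℓ : MvPolynomial (Fin 3) K} {x : Fin 3 → K}
    (hZ : {z | SingularOver (ℓ ^ 2) G B x z}.Finite) :
    {z | SingularOver (ℓ ^ 2) G B x z}.ncard ≤ 1 := by
  by_cases hx : eval x (ℓ ^ 2) = 0
  · rw [Set.ncard_le_one hZ]
    intro a ha b hb
    by_contra hab
    have hG : ∀ i, eval x (pderiv i G) = 0 := fun i => by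
      apply mul_left_cancel₀ (sub_ne_zero.mpr hab)
      linear_combination hb.mul_pderiv_eq i - ha.mul_pderiv_eq i
    have : Infinite K := IsAlgClosed.instInfinite
    refine Set.infinite_univ (hZ.subset fun z _ => ⟨ha.1, ?_, fun i => ?_⟩)
    · rw [hx]
      have := ha.2.1
      rw [hx] at this
      linear_combination this
    · rw [pderiv_sq, hG, ha.mul_pderiv_eq, hG]
      simp
  · exact ncard_singularOver_le_one hZ hx

/-- On a normal surface, `Q`, `G` and `B` have no common factor. -/
lemma not_dvd_of_finite (hQ : Q.IsHomogeneous 2) (hG : G.IsHomogeneous 3) (hB : B.IsHomogeneous 4)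
    (hQ0 : Q ≠ 0)
    (hE : {x : Projectivization K (Fin 3 → K) | ∃ z, SingularOver Q G B x.rep z}.Finite)
    (hZ : ∀ x, x ≠ 0 → {z | SingularOver Q G B x z}.Finite)
    {C : MvPolynomial (Fin 3) K} (hC : Irreducible C) (hCQ : C ∣ Q) (hCG : C ∣ G) : ¬ C ∣ B := by
  intro hCB
  obtain ⟨a, ha, ha2, hCa⟩ := exists_pos_degree_of_dvd hC hQ hQ0 hCQ
  obtain ⟨Q', rfl⟩ := hCQ
  obtain ⟨G', rfl⟩ := hCG
  obtain ⟨B', rfl⟩ := hCB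
  have hQ' : Q'.IsHomogeneous (2 - a) := isHomogeneous_quotient hCa hC.ne_zero
    (by rwa [show a + (2 - a) = 2 by omega])
  have hG' : G'.IsHomogeneous (3 - a) := isHomogeneous_quotient hCa hC.ne_zero
    (by rwa [show a + (3 - a) = 3 by omega])
  have hB' : B'.IsHomogeneous (4 - a) := isHomogeneous_quotient hCa hC.ne_zero
    (by rwa [show a + (4 - a) = 4 by omega])
  by_cases hCQ' : C ∣ Q'
  · by_cases hCG' : C ∣ G'
    · -- The double line `C = 0` meets `B' = 0`, and the whole line over a common point is singular.
      have ha1 : a = 1 := by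
        have hQ'0 := right_ne_zero_of_mul hQ0
        obtain ⟨b, hb, hb2, hCb⟩ := exists_pos_degree_of_dvd hC hQ' hQ'0 hCQ'
        have := hCa.inj_right hCb hC.ne_zero
        omega
      subst ha1
      obtain ⟨x, hx0, hxC, hxB⟩ := exists_common_zero hCa hC.ne_zero hB' (by norm_num)
      have : Infinite K := IsAlgClosed.instInfinite
      refine Set.infinite_univ ((hZ x hx0).subset fun z _ => singularOver_of_factor hxC ?_)
      obtain ⟨Q'', rfl⟩ := hCQ'
      obtain ⟨G'', rfl⟩ := hCG'
      simp [hxC, hxB]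
    · refine infinite_zeros_diff hCa ha hC hG' hCG' (hE.subset fun x hx => ?_)
      refine ⟨-eval x.rep B' / eval x.rep G', singularOver_of_factor hx.1 ?_⟩
      obtain ⟨Q'', rfl⟩ := hCQ'
      rw [map_mul, hx.1, div_mul_cancel₀ _ hx.2]
      ring
  · refine infinite_zeros_diff hCa ha hC hQ' hCQ' (hE.subset fun x hx => ?_)
    obtain ⟨z, hz⟩ := exists_quadratic_root hx.2 (eval x.rep G') (eval x.rep B')
    exact ⟨z, singularOver_of_factor hx.1 hz⟩

/-- On a normal surface, no component of `G = 0` is contained in all the curves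
`eliminant Q G B i = 0`: over a component of `G = 0` and of these curves on which `Q` is not zero,
the surface has a curve of singular points; if `Q` is zero on it, then `Q` is a square. -/
lemma exists_not_dvd_eliminant (hQ : Q.IsHomogeneous 2) (hG : G.IsHomogeneous 3)
    (hB : B.IsHomogeneous 4) (hQ0 : Q ≠ 0) (hG0 : G ≠ 0)
    (hE : {x : Projectivization K (Fin 3 → K) | ∃ z, SingularOver Q G B x.rep z}.Finite)
    (hZ : ∀ x, x ≠ 0 → {z | SingularOver Q G B x z}.Finite) (hsq : ¬ ∃ ℓ, Q = ℓ ^ 2)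
    {D : MvPolynomial (Fin 3) K} (hD : Irreducible D) (hDG : D ∣ G) :
    ∃ i, ¬ D ∣ eliminant Q G B i := by
  by_contra! h
  have h0 : (2 : K) = 0 := CharTwo.two_eq_zero
  by_cases hDQ : D ∣ Q
  · have hDB := not_dvd_of_finite hQ hG hB hQ0 hE hZ hD hDQ hDG
    have hDQi : ∀ i, D ∣ pderiv i Q := fun i => by
      have h1 : D ∣ pderiv i (Q * B) ^ 2 := by
        refine (dvd_add_left ?_).mp (h i)
        exact ((hDQ.mul_right B).mul_right _)
      have h2 := hD.prime.dvd_of_dvd_pow h1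
      rw [pderiv_mul] at h2
      exact (hD.prime.dvd_or_dvd ((dvd_add_left (hDQ.mul_right _)).mp h2)).resolve_right hDB
    obtain ⟨i, hi⟩ : ∃ i, pderiv i Q ≠ 0 := by
      by_contra! hQi
      exact hsq (exists_sq_of_pderiv_eq_zero hQi)
    obtain ⟨a, ha, ha1, hDa⟩ := exists_pos_degree_of_dvd hD hQ.pderiv hi (hDQi i)
    obtain rfl : a = 1 := by omega
    obtain ⟨Q', rfl⟩ := hDQ
    have hQ' : Q'.IsHomogeneous 1 := isHomogeneous_quotient hDa hD.ne_zero hQ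
    obtain ⟨j, hj⟩ : ∃ j, pderiv j D ≠ 0 := by
      by_contra! hDj
      obtain ⟨g, hg⟩ := exists_sq_of_pderiv_eq_zero hDj
      rw [hg] at hD
      exact not_irreducible_pow (by norm_num) hD
    have hDQ' : D ∣ Q' := by
      have h1 := hDQi j
      rw [pderiv_mul] at h1
      refine (hD.prime.dvd_or_dvd ((dvd_add_left (dvd_mul_right D _)).mp h1)).resolve_left
        fun h2 => ?_
      obtain ⟨b, hb, hb1, -⟩ := exists_pos_degree_of_dvd hD hDa.pderiv hj h2
      omega
    obtain ⟨c, rfl⟩ := hDQ'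
    have hc : c.IsHomogeneous 0 := isHomogeneous_quotient hDa hD.ne_zero hQ'
    rw [← totalDegree_zero_iff_isHomogeneous, totalDegree_eq_zero_iff_eq_C] at hc
    obtain ⟨γ, hγ⟩ := IsAlgClosed.exists_pow_nat_eq (coeff 0 c) two_pos
    refine hsq ⟨D * C γ, ?_⟩
    rw [hc, ← hγ, map_pow]
    ring
  · obtain ⟨a, ha, -, hDa⟩ := exists_pos_degree_of_dvd hD hG hG0 hDG
    refine infinite_zeros_diff hDa ha hD hQ hDQ (hE.subset fun x hx => ?_)
    obtain ⟨z, hz⟩ := exists_quadratic_root hx.2 0 (eval x.rep B)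
    have hzero : ∀ f, D ∣ f → eval x.rep f = 0 := by
      rintro _ ⟨f, rfl⟩
      rw [map_mul, hx.1, zero_mul]
    refine ⟨z, hzero G hDG, by linear_combination hz, fun i => ?_⟩
    have h1 := hzero _ (h i)
    have hB' : eval x.rep B = z ^ 2 * eval x.rep Q := by
      linear_combination hz - z ^ 2 * eval x.rep Q * h0
    simp only [eliminant, pderiv_mul, map_add, map_mul, map_pow, hB'] at h1
    have h2 : (eval x.rep Q * (z ^ 2 * eval x.rep (pderiv i Q) + z * eval x.rep (pderiv i G) +
        eval x.rep (pderiv i B))) ^ 2 = 0 := by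
      linear_combination h1 + (eval x.rep Q ^ 2 * (z ^ 3 * eval x.rep (pderiv i Q) *
        eval x.rep (pderiv i G) + z * eval x.rep (pderiv i G) * eval x.rep (pderiv i B))) * h0
    exact (mul_eq_zero.mp (pow_eq_zero_iff two_ne_zero |>.mp h2)).resolve_left hx.2

lemma exists_not_dvd_eliminantOfSq {ℓ : MvPolynomial (Fin 3) K} (hℓ : ℓ.IsHomogeneous 1)
    (hG : G.IsHomogeneous 3) (hG0 : G ≠ 0)
    (hE : {x : Projectivization K (Fin 3 → K) | ∃ z, SingularOver (ℓ ^ 2) G B x.rep z}.Finite)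
    {D : MvPolynomial (Fin 3) K} (hD : Irreducible D) (hDG : D ∣ G) (hDℓ : ¬ D ∣ ℓ) :
    ∃ i, ¬ D ∣ eliminantOfSq ℓ G B i := by
  by_contra! h
  have h0 : (2 : K) = 0 := CharTwo.two_eq_zero
  obtain ⟨a, ha, -, hDa⟩ := exists_pos_degree_of_dvd hD hG hG0 hDG
  refine infinite_zeros_diff hDa ha hD hℓ hDℓ (hE.subset fun x hx => ?_)
  obtain ⟨z, hz⟩ := exists_quadratic_root (pow_ne_zero 2 hx.2) 0 (eval x.rep B)
  have hzero : ∀ f, D ∣ f → eval x.rep f = 0 := by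
    rintro _ ⟨f, rfl⟩
    rw [map_mul, hx.1, zero_mul]
  refine ⟨z, hzero G hDG, by rw [map_pow]; linear_combination hz, fun i => ?_⟩
  have h1 := hzero _ (h i)
  have hB' : eval x.rep B = z ^ 2 * eval x.rep ℓ ^ 2 := by
    linear_combination hz - z ^ 2 * eval x.rep ℓ ^ 2 * h0
  simp only [eliminantOfSq, map_add, map_mul, map_pow, hB'] at h1
  have h2 : (eval x.rep ℓ * (z * eval x.rep (pderiv i G) + eval x.rep (pderiv i B))) ^ 2 = 0 := by
    linear_combination h1 + (eval x.rep ℓ ^ 2 * z * eval x.rep (pderiv i G) *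
      eval x.rep (pderiv i B)) * h0
  have h3 := (mul_eq_zero.mp (pow_eq_zero_iff two_ne_zero |>.mp h2)).resolve_left hx.2
  rw [pderiv_sq, map_zero]
  linear_combination h3

/-- If the tangent cone is not a double plane, there are at most `15` lines through the centre with
further singular points; at most `8` of them lie on the tangent cone, and only these can contain
two. -/
theorem sum_ncard_le_of_not_sq (hQ : Q.IsHomogeneous 2) (hG : G.IsHomogeneous 3)
    (hB : B.IsHomogeneous 4) (hQ0 : Q ≠ 0) (hG0 : G ≠ 0)
    (hE : {x : Projectivization K (Fin 3 → K) | ∃ z, SingularOver Q G B x.rep z}.Finite)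
    (hZ : ∀ x, x ≠ 0 → {z | SingularOver Q G B x z}.Finite) (hsq : ¬ ∃ ℓ, Q = ℓ ^ 2) :
    ∑ x ∈ hE.toFinset, {z | SingularOver Q G B x.rep z}.ncard ≤ 23 := by
  classical
  have h1 : 2 * hE.toFinset.card ≤ 3 * 10 := by
    refine two_mul_card_le_of_family hG (R := eliminant Q G B) (fun i => ?_) hG0
      (fun D hD hDG => exists_not_dvd_eliminant hQ hG hB hQ0 hG0 hE hZ hsq hD hDG) _ fun x hx => ?_
    · exact ((hQ.mul hB).pderiv.pow 2).add ((hQ.mul hB).mul (hG.pderiv.pow 2))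
    · obtain ⟨z, hz⟩ := hE.mem_toFinset.mp hx
      obtain ⟨v, hv, hvG⟩ := exists_dirDeriv_eq_zero x.rep G
      exact ⟨hz.1, hz.eval_eliminant, v, hv, hvG, hz.dirDeriv_eliminant hvG⟩
  have h2 : (hE.toFinset.filter fun x => eval x.rep Q = 0).card ≤ 2 * 4 := by
    refine card_le_of_family hQ (R := fun o : Option (Fin 3) => o.elim B fun i => X i * G) ?_ hQ0 ?_
      _ fun x hx => ?_
    · rintro (_ | i)
      · exact hB
      · exact (isHomogeneous_X K i).mul hG
    · intro D hD hDQ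
      by_contra! h
      have hX : ¬ ∀ i : Fin 3, D ∣ X i := fun hX => by
        have h01 := (hD.dvd_irreducible_iff_associated X_prime.irreducible).mp (hX 0)
        exact absurd (X_dvd_X.mp (h01.symm.dvd.trans (hX 1))) (by decide)
      obtain ⟨i, hi⟩ := not_forall.mp hX
      exact not_dvd_of_finite hQ hG hB hQ0 hE hZ hD hDQ
        ((hD.prime.dvd_or_dvd (h (some i))).resolve_left hi) (h none)
    · obtain ⟨hx, hxQ⟩ := Finset.mem_filter.mp hx
      obtain ⟨z, hz⟩ := hE.mem_toFinset.mp hx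
      refine ⟨hxQ, ?_⟩
      rintro (_ | i)
      · have := hz.2.1
        rwa [hxQ, mul_zero, zero_add] at this
      · change eval x.rep (X i * G) = 0
        rw [map_mul, hz.1, mul_zero]
  have h3 : ∑ x ∈ hE.toFinset, {z | SingularOver Q G B x.rep z}.ncard ≤
      ∑ x ∈ hE.toFinset, (1 + if eval x.rep Q = 0 then 1 else 0) := by
    refine Finset.sum_le_sum fun x _ => ?_
    split_ifs with hx
    · exact ncard_singularOver_le_two (hZ _ x.rep_nonzero)
    · exact ncard_singularOver_le_one (hZ _ x.rep_nonzero) hx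
  rw [Finset.sum_add_distrib, ← Finset.card_filter, Finset.sum_const, smul_eq_mul] at h3
  omega

/-- If the tangent cone is the double plane `ℓ ^ 2 = 0`, there are at most `12` further singular
points outside of it, and at most `4` in it. -/
theorem sum_ncard_le_of_sq {ℓ : MvPolynomial (Fin 3) K} (hℓ : ℓ.IsHomogeneous 1)
    (hG : G.IsHomogeneous 3) (hB : B.IsHomogeneous 4) (hℓ0 : ℓ ≠ 0) (hG0 : G ≠ 0)
    (hE : {x : Projectivization K (Fin 3 → K) | ∃ z, SingularOver (ℓ ^ 2) G B x.rep z}.Finite)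
    (hZ : ∀ x, x ≠ 0 → {z | SingularOver (ℓ ^ 2) G B x z}.Finite) :
    ∑ x ∈ hE.toFinset, {z | SingularOver (ℓ ^ 2) G B x.rep z}.ncard ≤ 15 := by
  classical
  have hℓi := irreducible_of_isHomogeneous_one hℓ hℓ0
  have h3 : ∑ x ∈ hE.toFinset, {z | SingularOver (ℓ ^ 2) G B x.rep z}.ncard ≤
      ∑ x ∈ hE.toFinset, 1 :=
    Finset.sum_le_sum fun x _ => ncard_singularOver_sq_le_one (hZ _ x.rep_nonzero)
  rw [Finset.sum_const, smul_eq_mul, mul_one,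
    ← Finset.card_filter_add_card_filter_not (fun x => eval x.rep ℓ = 0)] at h3
  -- Only the part `G'` of `G` prime to `ℓ` matters for the points with `ℓ ≠ 0`.
  obtain ⟨G', hGG', hℓG'⟩ :=
    (FiniteMultiplicity.of_not_isUnit hℓi.not_isUnit hG0).exists_eq_pow_mul_and_not_dvd
  set k := multiplicity ℓ G
  have hG'0 : G' ≠ 0 := right_ne_zero_of_mul (hGG' ▸ hG0)
  obtain ⟨a, g, hag, ha, hg⟩ := isHomogeneous_of_mul (hGG' ▸ hG) (hGG' ▸ hG0)
  have hak : k = a := by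
    have h := (hℓ.pow k).inj_right ha (pow_ne_zero _ hℓ0)
    rwa [one_mul] at h
  subst hak
  have h1 : 2 * (hE.toFinset.filter fun x => ¬ eval x.rep ℓ = 0).card ≤ g * 8 := by
    refine two_mul_card_le_of_family hg (R := eliminantOfSq ℓ G B) (fun i => ?_) hG'0
      (fun D hD hDG => exists_not_dvd_eliminantOfSq hℓ hG hG0 hE hD
        (hDG.trans ⟨_, hGG'.trans (mul_comm _ _)⟩) fun hDℓ => hℓG' ?_) _ fun x hx => ?_
    · exact ((hℓ.pow 2).mul (hB.pderiv.pow 2)).add (hB.mul (hG.pderiv.pow 2))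
    · exact ((hD.dvd_irreducible_iff_associated hℓi).mp hDℓ).symm.dvd.trans hDG
    · obtain ⟨hx, hxℓ⟩ := Finset.mem_filter.mp hx
      obtain ⟨z, hz⟩ := hE.mem_toFinset.mp hx
      obtain ⟨v, hv, hvG⟩ := exists_dirDeriv_eq_zero x.rep G'
      have hxG' : eval x.rep G' = 0 := by
        have := hz.1
        rw [hGG', map_mul, map_pow] at this
        exact (mul_eq_zero.mp this).resolve_left (pow_ne_zero _ hxℓ)
      have hvG' : dirDeriv x.rep v G = 0 := by
        rw [hGG', dirDeriv_mul, hvG, hxG', mul_zero, mul_zero, zero_add]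
      exact ⟨hxG', hz.eval_eliminantOfSq, v, hv, hvG, hz.dirDeriv_eliminantOfSq hvG'⟩
  have hmem : ∀ x ∈ hE.toFinset.filter fun x => eval x.rep ℓ = 0,
      eval x.rep ℓ = 0 ∧ eval x.rep G = 0 ∧ eval x.rep B = 0 := fun x hx => by
    obtain ⟨hx, hxℓ⟩ := Finset.mem_filter.mp hx
    obtain ⟨z, hz⟩ := hE.mem_toFinset.mp hx
    refine ⟨hxℓ, hz.1, ?_⟩
    have := hz.2.1
    rw [map_pow, hxℓ] at this
    linear_combination this
  by_cases hℓG : ℓ ∣ G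
  · have hk : k ≠ 0 := fun hk => by
      rw [hk, pow_zero, one_mul] at hGG'
      exact hℓG' (hGG' ▸ hℓG)
    have hℓB := not_dvd_of_finite (hℓ.pow 2) hG hB (pow_ne_zero 2 hℓ0) hE hZ hℓi
      (dvd_pow_self ℓ two_ne_zero) hℓG
    have h2 := card_finset_le hℓ hB hℓ0 (hℓi.isRelPrime_iff_not_dvd.mpr hℓB) _
      fun x hx => ⟨(hmem x hx).1, (hmem x hx).2.2⟩
    omega
  · have h2 := card_finset_le hℓ hG hℓ0 (hℓi.isRelPrime_iff_not_dvd.mpr hℓG) _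
      fun x hx => ⟨(hmem x hx).1, (hmem x hx).2.1⟩
    omega

end DoubleCover

section Projection

/-! ### Singular vectors and changes of coordinates -/

/-- The affine cone over the singular locus of `{F = 0}`. -/
def IsSingularVector {σ : Type*} (F : MvPolynomial σ K) (w : σ → K) : Prop :=
  eval w F = 0 ∧ ∀ i, eval w (pderiv i F) = 0

lemma IsSingularVector.smul {σ : Type*} {F : MvPolynomial σ K} {n : ℕ} (hF : F.IsHomogeneous n)
    {w : σ → K} (h : IsSingularVector F w) (t : K) : IsSingularVector F (t • w) := by
  refine ⟨?_, fun i => ?_⟩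
  · rw [eval_smul_of_isHomogeneous hF, h.1, mul_zero]
  · rw [eval_smul_of_isHomogeneous hF.pderiv, h.2, mul_zero]

lemma mk_mem_singularPoints {F : MvPolynomial (Fin 4) K} {n : ℕ} (hF : F.IsHomogeneous n)
    {w : Fin 4 → K} (hw : w ≠ 0) :
    Projectivization.mk K w hw ∈ singularPoints F ↔ IsSingularVector F w := by
  obtain ⟨a, ha⟩ := Projectivization.exists_smul_eq_mk_rep K w hw
  change IsSingularVector F (Projectivization.mk K w hw).rep ↔ _
  rw [← ha]
  refine ⟨fun h => ?_, fun h => h.smul hF _⟩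
  have := h.smul hF ((a⁻¹ : Kˣ) : K)
  rwa [← Units.smul_def, smul_smul, inv_mul_cancel, one_smul] at this

/-- The chain rule for the substitution of the values `g` into a polynomial. -/
lemma derivation_aeval {σ S : Type*} [Fintype σ] [CommRing S] [Algebra K S] (D : Derivation K S S)
    (g : σ → S) (f : MvPolynomial σ K) :
    D (aeval g f) = ∑ i, aeval g (pderiv i f) * D (g i) := by
  classical
  induction f using MvPolynomial.induction_on with
  | C a => simp [D.map_algebraMap]
  | add p q hp hq => simp only [map_add, hp, hq, add_mul, Finset.sum_add_distrib]
  | mul_X p j hp =>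
    simp only [map_mul, Derivation.leibniz, hp, aeval_X, smul_eq_mul, pderiv_X, map_add, add_mul,
      Finset.sum_add_distrib, Pi.single_apply, apply_ite (aeval g), map_zero, mul_ite,
      mul_one, mul_zero, ite_mul, zero_mul, Finset.sum_ite_eq, Finset.mem_univ,
      if_true, Finset.mul_sum, mul_assoc]

lemma pderiv_changeCoordinates (A : GL (Fin 4) K) (F : MvPolynomial (Fin 4) K) (j : Fin 4) :
    pderiv j (changeCoordinates A F) =
      ∑ i, C ((A : Matrix (Fin 4) (Fin 4) K) i j) * changeCoordinates A (pderiv i F) := by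
  rw [changeCoordinates, derivation_aeval]
  refine Finset.sum_congr rfl fun i _ => ?_
  simp [changeCoordinates, pderiv_X, Pi.single_apply, mul_comm]

lemma eval_changeCoordinates (A : GL (Fin 4) K) (F : MvPolynomial (Fin 4) K) (w : Fin 4 → K) :
    eval w (changeCoordinates A F) = eval ((A : Matrix (Fin 4) (Fin 4) K).mulVec w) F := by
  have h : (aeval w).comp (aeval fun i => ∑ j, C ((A : Matrix (Fin 4) (Fin 4) K) i j) * X j) =
      (aeval ((A : Matrix (Fin 4) (Fin 4) K).mulVec w) : MvPolynomial (Fin 4) K →ₐ[K] K) := by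
    ext i
    simp [Matrix.mulVec, dotProduct]
  exact DFunLike.congr_fun h F

lemma changeCoordinates_mul (A A' : GL (Fin 4) K) (F : MvPolynomial (Fin 4) K) :
    changeCoordinates A' (changeCoordinates A F) = changeCoordinates (A * A') F := by
  have h : (aeval fun i => ∑ j, C ((A' : Matrix (Fin 4) (Fin 4) K) i j) * X j).comp
      (aeval fun i => ∑ j, C ((A : Matrix (Fin 4) (Fin 4) K) i j) * X j) =
      (aeval fun i => ∑ j, C (((A * A' : GL (Fin 4) K) : Matrix (Fin 4) (Fin 4) K) i j) * X j :
        MvPolynomial (Fin 4) K →ₐ[K] MvPolynomial (Fin 4) K) := by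
    ext1 i
    simp only [AlgHom.comp_apply, aeval_X, map_sum, map_mul, algHom_C, algebraMap_eq,
      Units.val_mul, Matrix.mul_apply, Finset.mul_sum, Finset.sum_mul]
    rw [Finset.sum_comm]
    simp only [mul_assoc]
  exact DFunLike.congr_fun h F

lemma changeCoordinates_one (F : MvPolynomial (Fin 4) K) : changeCoordinates 1 F = F := by
  simp [changeCoordinates, Matrix.one_apply, apply_ite (C : K → MvPolynomial (Fin 4) K)]

lemma changeCoordinates_eq_zero {A : GL (Fin 4) K} {F : MvPolynomial (Fin 4) K}
    (h : changeCoordinates A F = 0) : F = 0 := by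
  rw [← changeCoordinates_one F, ← mul_inv_cancel A, ← changeCoordinates_mul, h]
  exact map_zero (aeval _)

lemma isHomogeneous_changeCoordinates (A : GL (Fin 4) K) {F : MvPolynomial (Fin 4) K} {n : ℕ}
    (hF : F.IsHomogeneous n) : (changeCoordinates A F).IsHomogeneous n := by
  have := hF.aeval (fun i => ∑ j, C ((A : Matrix (Fin 4) (Fin 4) K) i j) * X j) (n := 1)
    fun i => IsHomogeneous.sum _ _ _ fun j _ => isHomogeneous_C_mul_X _ j
  rwa [one_mul] at this

lemma IsSingularVector.changeCoordinates {A : GL (Fin 4) K} {F : MvPolynomial (Fin 4) K}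
    {w : Fin 4 → K} (h : IsSingularVector F ((A : Matrix (Fin 4) (Fin 4) K).mulVec w)) :
    IsSingularVector (changeCoordinates A F) w := by
  refine ⟨by rw [eval_changeCoordinates, h.1], fun j => ?_⟩
  rw [pderiv_changeCoordinates]
  simp [eval_changeCoordinates, h.2]

lemma singularPoints_changeCoordinates (A : GL (Fin 4) K) {F : MvPolynomial (Fin 4) K} {n : ℕ}
    (hF : F.IsHomogeneous n) :
    singularPoints (changeCoordinates A F) = (fun P => A • P) ⁻¹' singularPoints F := by
  ext P
  induction P with | h w hw =>
  have hA : (A : Matrix (Fin 4) (Fin 4) K).mulVec w ≠ 0 := (smul_ne_zero_iff_ne A).mpr hw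
  have hAw : A • Projectivization.mk K w hw =
    Projectivization.mk K ((A : Matrix (Fin 4) (Fin 4) K).mulVec w) hA := rfl
  rw [Set.mem_preimage, hAw, mk_mem_singularPoints hF,
    mk_mem_singularPoints (isHomogeneous_changeCoordinates A hF)]
  refine ⟨fun h => ?_, fun h => h.changeCoordinates⟩
  have h1 : IsSingularVector (QuarticSurface.changeCoordinates A⁻¹
      (QuarticSurface.changeCoordinates A F)) ((A : Matrix (Fin 4) (Fin 4) K).mulVec w) := by
    refine IsSingularVector.changeCoordinates ?_
    rwa [Matrix.mulVec_mulVec, ← Units.val_mul, inv_mul_cancel, Units.val_one, Matrix.one_mulVec]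
  rwa [changeCoordinates_mul, mul_inv_cancel, changeCoordinates_one] at h1

lemma ncard_singularPoints_changeCoordinates (A : GL (Fin 4) K) {F : MvPolynomial (Fin 4) K}
    {n : ℕ} (hF : F.IsHomogeneous n) :
    (singularPoints (changeCoordinates A F)).ncard = (singularPoints F).ncard := by
  rw [singularPoints_changeCoordinates A hF]
  exact Set.ncard_preimage_of_injective_subset_range (MulAction.injective A)
    fun P _ => MulAction.surjective A P

/-! ### Counting singular points along the projection -/

/-- The quartic form `z ^ 2 Q + z G + B`. -/
noncomputable def quarticForm (Q G B : MvPolynomial (Fin 3) K) : MvPolynomial (Fin 4) K :=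
  X 3 ^ 2 * rename Fin.castSucc Q + X 3 * rename Fin.castSucc G + rename Fin.castSucc B

lemma isHomogeneous_quarticForm {Q G B : MvPolynomial (Fin 3) K} (hQ : Q.IsHomogeneous 2)
    (hG : G.IsHomogeneous 3) (hB : B.IsHomogeneous 4) : (quarticForm Q G B).IsHomogeneous 4 :=
  ((((isHomogeneous_X K 3).pow 2).mul hQ.rename_isHomogeneous).add
    ((isHomogeneous_X K 3).mul hG.rename_isHomogeneous)).add hB.rename_isHomogeneous

lemma pderiv_last_rename (f : MvPolynomial (Fin 3) K) :
    pderiv (3 : Fin 4) (rename Fin.castSucc f) = 0 := by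
  classical
  refine pderiv_eq_zero_of_notMem_vars fun h => ?_
  obtain ⟨i, -, hi⟩ := Finset.mem_image.mp (vars_rename _ _ h)
  exact (Fin.castSucc_lt_last i).ne hi

lemma pderiv_last_quarticForm [CharP K 2] (Q G B : MvPolynomial (Fin 3) K) :
    pderiv 3 (quarticForm Q G B) = rename Fin.castSucc G := by
  rw [quarticForm, map_add, map_add, pderiv_mul, pderiv_mul, pderiv_sq, pderiv_last_rename,
    pderiv_last_rename, pderiv_last_rename, pderiv_X_self]
  ring

lemma isSingularVector_quarticForm [CharP K 2] (Q G B : MvPolynomial (Fin 3) K) (w : Fin 4 → K) :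
    IsSingularVector (quarticForm Q G B) w ↔ SingularOver Q G B (w ∘ Fin.castSucc) (w 3) := by
  have h (i : Fin 3) : eval w (pderiv i.castSucc (quarticForm Q G B)) =
      w 3 ^ 2 * eval (w ∘ Fin.castSucc) (pderiv i Q) + w 3 * eval (w ∘ Fin.castSucc) (pderiv i G) +
        eval (w ∘ Fin.castSucc) (pderiv i B) := by
    have h3 : (3 : Fin 4) ≠ i.castSucc := (Fin.castSucc_lt_last i).ne'
    rw [quarticForm, map_add (pderiv _), map_add (pderiv _), pderiv_mul, pderiv_mul, pderiv_sq,
      pderiv_X_of_ne h3]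
    simp [pderiv_rename (Fin.castSucc_injective 3), eval_rename]
  have h3 : eval w (pderiv 3 (quarticForm Q G B)) = eval (w ∘ Fin.castSucc) G := by
    rw [pderiv_last_quarticForm, eval_rename]
  have h0 : eval w (quarticForm Q G B) = w 3 ^ 2 * eval (w ∘ Fin.castSucc) Q +
      w 3 * eval (w ∘ Fin.castSucc) G + eval (w ∘ Fin.castSucc) B := by
    simp [quarticForm, eval_rename]
  constructor
  · intro hw
    have hG : eval (w ∘ Fin.castSucc) G = 0 := by rw [← h3, hw.2]
    refine ⟨hG, ?_, fun i => by rw [← h, hw.2]⟩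
    have := hw.1
    rw [h0, hG] at this
    linear_combination this
  · intro hw
    refine ⟨by rw [h0, hw.1]; linear_combination hw.2.1, fun i => ?_⟩
    induction i using Fin.lastCases with
    | last => exact h3.trans hw.1
    | cast i => rw [h, hw.2.2]

/-- The point `(x, z)` of the line through the centre of projection given by `x`. -/
def linePoint (x : Fin 3 → K) (hx : x ≠ 0) (z : K) : Projectivization K (Fin 4 → K) :=
  Projectivization.mk K (Fin.snoc x z : Fin 4 → K) fun h => hx (by
    ext i
    have := congr_fun h i.castSucc
    rwa [Fin.snoc_castSucc] at this)

lemma linePoint_eq {x y : Fin 3 → K} {hx : x ≠ 0} {hy : y ≠ 0} {z t : K}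
    (h : linePoint x hx z = linePoint y hy t) : ∃ a : K, a • y = x ∧ a * t = z := by
  obtain ⟨a, ha⟩ := (Projectivization.mk_eq_mk_iff' K _ _ _ _).mp h
  refine ⟨a, ?_, ?_⟩
  · ext i
    have := congr_fun ha i.castSucc
    simpa using this
  · have := congr_fun ha (Fin.last 3)
    rwa [Pi.smul_apply, Fin.snoc_last, Fin.snoc_last] at this

lemma linePoint_injective (x : Fin 3 → K) (hx : x ≠ 0) : Function.Injective (linePoint x hx) := by
  intro z t h
  obtain ⟨a, ha, hz⟩ := linePoint_eq h
  have : a = 1 := by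
    by_contra h1
    refine hx ((smul_eq_zero.mp ?_).resolve_left (sub_ne_zero.mpr h1))
    rw [sub_smul, ha, one_smul, sub_self]
  rw [← hz, this, one_mul]

lemma linePoint_mem_singularPoints [CharP K 2] {Q G B : MvPolynomial (Fin 3) K}
    (hQ : Q.IsHomogeneous 2) (hG : G.IsHomogeneous 3) (hB : B.IsHomogeneous 4) {x : Fin 3 → K}
    (hx : x ≠ 0) (z : K) :
    linePoint x hx z ∈ singularPoints (quarticForm Q G B) ↔ SingularOver Q G B x z := by
  rw [linePoint, mk_mem_singularPoints (isHomogeneous_quarticForm hQ hG hB),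
    isSingularVector_quarticForm]
  have h1 : (Fin.snoc x z : Fin 4 → K) ∘ Fin.castSucc = x := by
    ext i
    exact Fin.snoc_castSucc (α := fun _ => K) z x i
  have h2 : (Fin.snoc x z : Fin 4 → K) 3 = z := Fin.snoc_last (α := fun _ => K) z x
  rw [h1, h2]

variable [CharP K 2] {Q G B : MvPolynomial (Fin 3) K}

lemma finite_singularOver (hQ : Q.IsHomogeneous 2) (hG : G.IsHomogeneous 3)
    (hB : B.IsHomogeneous 4) (hfin : (singularPoints (quarticForm Q G B)).Finite) (x : Fin 3 → K)
    (hx : x ≠ 0) : {z | SingularOver Q G B x z}.Finite :=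
  (hfin.preimage (linePoint_injective x hx).injOn).subset fun z hz =>
    (linePoint_mem_singularPoints hQ hG hB hx z).mpr hz

lemma finite_image_singularOver (hQ : Q.IsHomogeneous 2) (hG : G.IsHomogeneous 3)
    (hB : B.IsHomogeneous 4) (hfin : (singularPoints (quarticForm Q G B)).Finite) :
    {x : Projectivization K (Fin 3 → K) | ∃ z, SingularOver Q G B x.rep z}.Finite := by
  choose! z hz using fun (x : Projectivization K (Fin 3 → K))
    (h : ∃ z, SingularOver Q G B x.rep z) => h
  refine Set.Finite.of_finite_image (f := fun x => linePoint x.rep x.rep_nonzero (z x))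
    (hfin.subset ?_) ?_
  · rintro _ ⟨x, hx, rfl⟩
    exact (linePoint_mem_singularPoints hQ hG hB x.rep_nonzero _).mpr (hz x hx)
  · intro x _ y _ hxy
    obtain ⟨a, ha, -⟩ := linePoint_eq hxy
    by_contra hne
    exact rep_notMem_span hne (Submodule.mem_span_singleton.mpr ⟨a, ha⟩)

/-- Apart from the centre of projection, the singular points lie on lines `x` through the
centre. -/
lemma ncard_singularPoints_le (hQ : Q.IsHomogeneous 2) (hG : G.IsHomogeneous 3)
    (hB : B.IsHomogeneous 4) (hfin : (singularPoints (quarticForm Q G B)).Finite) :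
    (singularPoints (quarticForm Q G B)).ncard ≤
      1 + ∑ x ∈ (finite_image_singularOver hQ hG hB hfin).toFinset,
        {z | SingularOver Q G B x.rep z}.ncard := by
  classical
  have hZ := finite_singularOver hQ hG hB hfin
  set E := (finite_image_singularOver hQ hG hB hfin).toFinset with hE
  have he : (Pi.single 3 1 : Fin 4 → K) ≠ 0 := by simp
  let T : Finset (Projectivization K (Fin 4 → K)) := {Projectivization.mk K _ he} ∪
    E.biUnion fun x => (hZ x.rep x.rep_nonzero).toFinset.image (linePoint x.rep x.rep_nonzero)
  have hsub : singularPoints (quarticForm Q G B) ⊆ T := by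
    intro P hP
    induction P with | h w hw =>
    rw [mk_mem_singularPoints (isHomogeneous_quarticForm hQ hG hB)] at hP
    rw [Finset.mem_coe, Finset.mem_union, Finset.mem_singleton, Finset.mem_biUnion]
    by_cases hx : w ∘ Fin.castSucc = 0
    · left
      rw [Projectivization.mk_eq_mk_iff']
      refine ⟨w 3, ?_⟩
      ext i
      induction i using Fin.lastCases with
      | last => simp
      | cast i =>
        have h3 : i.castSucc ≠ (3 : Fin 4) := (Fin.castSucc_lt_last i).ne
        have := congr_fun hx i
        simp only [Function.comp_apply, Pi.zero_apply] at this
        simp [h3, this]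
    · right
      obtain ⟨a, ha⟩ := Projectivization.exists_smul_eq_mk_rep K _ hx
      have haw : IsSingularVector (quarticForm Q G B) ((a : K) • w) :=
        hP.smul (isHomogeneous_quarticForm hQ hG hB) a
      rw [isSingularVector_quarticForm] at haw
      have hrep : ((a : K) • w) ∘ Fin.castSucc = (Projectivization.mk K _ hx).rep := ha
      rw [hrep] at haw
      refine ⟨Projectivization.mk K _ hx, ?_, Finset.mem_image.mpr ⟨((a : K) • w) 3, ?_, ?_⟩⟩
      · rw [hE, Set.Finite.mem_toFinset]
        exact ⟨_, haw⟩
      · rw [Set.Finite.mem_toFinset]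
        exact haw
      · rw [linePoint, Projectivization.mk_eq_mk_iff']
        refine ⟨a, ?_⟩
        ext i
        induction i using Fin.lastCases with
        | last => rw [Fin.snoc_last]; rfl
        | cast i =>
          rw [Fin.snoc_castSucc, ← hrep]
          rfl
  calc (singularPoints (quarticForm Q G B)).ncard ≤ (T : Set _).ncard :=
        Set.ncard_le_ncard hsub T.finite_toSet
    _ = T.card := Set.ncard_coe_finset T
    _ ≤ 1 + ∑ x ∈ E, ((hZ x.rep x.rep_nonzero).toFinset.image
          (linePoint x.rep x.rep_nonzero)).card :=
        (Finset.card_union_le _ _).trans (add_le_add (Finset.card_singleton _).le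
          Finset.card_biUnion_le)
    _ ≤ _ := by
        refine Nat.add_le_add_left (Finset.sum_le_sum fun x _ => Finset.card_image_le.trans ?_) _
        rw [Set.ncard_eq_toFinset_card _ (hZ x.rep x.rep_nonzero)]

end Projection

section Development

/-! ### The development at a double point -/

lemma homogeneousComponent_aeval {σ τ : Type*} {L : σ → MvPolynomial τ K}
    (hL : ∀ i, (L i).IsHomogeneous 1) (f : MvPolynomial σ K) (d : ℕ) :
    homogeneousComponent d (aeval L f) = aeval L (homogeneousComponent d f) := by
  have h (k : ℕ) : (aeval L (homogeneousComponent k f)).IsHomogeneous k := by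
    have := (homogeneousComponent_isHomogeneous k f).aeval L hL
    rwa [one_mul] at this
  conv_lhs => rw [← sum_homogeneousComponent f]
  rw [map_sum, map_sum, Finset.sum_congr rfl fun k _ => homogeneousComponent_of_mem (h k)]
  rw [Finset.sum_ite_eq]
  split_ifs with hd
  · rfl
  · rw [homogeneousComponent_eq_zero d f (by simpa using hd), map_zero]

/-- A form is a polynomial in the last variable whose coefficients are forms. -/
lemma exists_last_development {F : MvPolynomial (Fin 4) K} (hF : F.IsHomogeneous 4) :
    ∃ c : ℕ → MvPolynomial (Fin 3) K, (∀ k ≤ 4, (c k).IsHomogeneous (4 - k)) ∧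
      F = ∑ k ∈ Finset.range 5, X 3 ^ k * rename Fin.castSucc (c k) := by
  set F' := rename (finRotate 4) F with hF'
  have hF'h : F'.IsHomogeneous 4 := hF.rename_isHomogeneous
  have hdeg : (finSuccEquiv K 3 F').natDegree < 5 := by
    rw [natDegree_finSuccEquiv]
    exact Nat.lt_succ_of_le ((degreeOf_le_totalDegree F' 0).trans hF'h.totalDegree_le)
  refine ⟨fun k => (finSuccEquiv K 3 F').coeff k, fun k hk =>
    hF'h.finSuccEquiv_coeff_isHomogeneous k _ (by omega), ?_⟩
  -- The inverse of the identification with polynomials in the last variable.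
  let ψ : Polynomial (MvPolynomial (Fin 3) K) →ₐ[K] MvPolynomial (Fin 4) K :=
    Polynomial.aevalTower (rename Fin.castSucc) (X 3)
  have hψ : (ψ.comp (finSuccEquiv K 3 : _ →ₐ[K] _)).comp (rename (finRotate 4)) =
      AlgHom.id K (MvPolynomial (Fin 4) K) := by
    ext1 i
    induction i using Fin.lastCases with
    | last =>
      have : finRotate 4 (Fin.last 3) = 0 := finRotate_last
      simp only [AlgHom.comp_apply, rename_X, this]
      change ψ (finSuccEquiv K 3 (X 0)) = X 3
      rw [finSuccEquiv_X_zero, Polynomial.aevalTower_X]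
    | cast i =>
      have : finRotate 4 i.castSucc = i.succ := by
        rw [finRotate_apply, Fin.coeSucc_eq_succ]
      simp only [AlgHom.comp_apply, rename_X, this]
      change ψ (finSuccEquiv K 3 (X i.succ)) = X i.castSucc
      rw [finSuccEquiv_X_succ, Polynomial.aevalTower_C, rename_X]
  have h1 : ψ (finSuccEquiv K 3 F') = F := DFunLike.congr_fun hψ F
  conv_lhs => rw [← h1, Polynomial.as_sum_range' _ _ hdeg, map_sum]
  refine Finset.sum_congr rfl fun k _ => ?_
  rw [← Polynomial.C_mul_X_pow_eq_monomial, map_mul, map_pow, Polynomial.aevalTower_X,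
    Polynomial.aevalTower_C, mul_comm]

lemma translate_changeCoordinates (A : GL (Fin 4) K) (F : MvPolynomial (Fin 4) K)
    (w : Fin 4 → K) :
    translate (changeCoordinates A F) w =
      changeCoordinates A (translate F ((A : Matrix (Fin 4) (Fin 4) K).mulVec w)) := by
  have h : (aeval fun i => C (w i) + X i).comp
      (aeval fun i => ∑ j, C ((A : Matrix (Fin 4) (Fin 4) K) i j) * X j) =
      (aeval fun i => ∑ j, C ((A : Matrix (Fin 4) (Fin 4) K) i j) * X j).comp
      (aeval fun i => C ((A : Matrix (Fin 4) (Fin 4) K).mulVec w i) + X i :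
        MvPolynomial (Fin 4) K →ₐ[K] MvPolynomial (Fin 4) K) := by
    ext1 i
    simp [Matrix.mulVec, dotProduct, mul_add, Finset.sum_add_distrib, algHom_C]
  exact DFunLike.congr_fun h F

lemma homogeneousComponent_changeCoordinates (A : GL (Fin 4) K) (F : MvPolynomial (Fin 4) K)
    (d : ℕ) : homogeneousComponent d (changeCoordinates A F) =
      changeCoordinates A (homogeneousComponent d F) :=
  homogeneousComponent_aeval (fun _ => IsHomogeneous.sum _ _ _
    fun _ _ => isHomogeneous_C_mul_X _ _) F d

lemma exists_GL_mulVec_eq {p : Fin 4 → K} (hp : p ≠ 0) :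
    ∃ A : GL (Fin 4) K, (A : Matrix (Fin 4) (Fin 4) K).mulVec (Pi.single 3 1) = p := by
  have he : (Pi.single 3 1 : Fin 4 → K) ≠ 0 := by simp
  have : MulAction.IsPretransitive (Matrix.SpecialLinearGroup (Fin 4) K)
    (Projectivization K (Fin 4 → K)) := MulAction.isPretransitive_of_is_two_pretransitive
  obtain ⟨g, hg⟩ := MulAction.exists_smul_eq (Matrix.SpecialLinearGroup (Fin 4) K)
    (Projectivization.mk K _ he) (Projectivization.mk K p hp)
  have hne : (g : Matrix (Fin 4) (Fin 4) K).mulVec (Pi.single 3 1) ≠ 0 := fun h => he (by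
    have := congr_arg ((g⁻¹ : Matrix.SpecialLinearGroup (Fin 4) K) :
      Matrix (Fin 4) (Fin 4) K).mulVec h
    rwa [Matrix.mulVec_mulVec, ← Matrix.SpecialLinearGroup.coe_mul, inv_mul_cancel,
      Matrix.SpecialLinearGroup.coe_one, Matrix.one_mulVec, Matrix.mulVec_zero] at this)
  have hg' : Projectivization.mk K _ hne = Projectivization.mk K p hp := hg
  obtain ⟨a, ha⟩ := (Projectivization.mk_eq_mk_iff K _ _ _ _).mp hg'
  refine ⟨Matrix.GeneralLinearGroup.mkOfDetNeZero
    ((a⁻¹ : Kˣ) • (g : Matrix (Fin 4) (Fin 4) K)) ?_, ?_⟩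
  · rw [Units.smul_def, Matrix.det_smul, g.det_coe, mul_one]
    exact pow_ne_zero _ (Units.ne_zero _)
  · change ((a⁻¹ : Kˣ) • (g : Matrix (Fin 4) (Fin 4) K)).mulVec _ = p
    rw [Matrix.smul_mulVec, ← ha, smul_smul, inv_mul_cancel, one_smul]

/-- In coordinates with the double point `P` at `(0, 0, 0, 1)`, a quartic form is
`z ^ 2 Q + z G + B` with `Q ≠ 0`. -/
lemma exists_taylorDevelopment {F : MvPolynomial (Fin 4) K} (hF : F.IsHomogeneous 4)
    {P : Projectivization K (Fin 4 → K)} (hP : HasMultiplicity F P 2) :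
    ∃ (A : GL (Fin 4) K) (Q G B : MvPolynomial (Fin 3) K), IsTaylorDevelopment F P A Q G B ∧
      Q ≠ 0 := by
  obtain ⟨A, hA⟩ := exists_GL_mulVec_eq P.rep_nonzero
  obtain ⟨c, hc, hFc⟩ := exists_last_development (isHomogeneous_changeCoordinates A hF)
  set T := translate (changeCoordinates A F) (Pi.single 3 1) with hT
  have hTA : ∀ d, homogeneousComponent d T =
      changeCoordinates A (homogeneousComponent d (translate F P.rep)) := fun d => by
    rw [hT, translate_changeCoordinates, hA, homogeneousComponent_changeCoordinates]
  have hT0 : ∀ d < 2, homogeneousComponent d T = 0 := fun d hd => by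
    rw [hTA, hP.1 d hd]
    exact map_zero (aeval _)
  have hT2 : homogeneousComponent 2 T ≠ 0 := fun h => by
    rw [hTA] at h
    exact hP.2 (changeCoordinates_eq_zero h)
  have hTc : T = ∑ k ∈ Finset.range 5, (1 + X 3) ^ k * rename Fin.castSucc (c k) := by
    rw [hT, hFc, translate, map_sum]
    refine Finset.sum_congr rfl fun k _ => ?_
    have h3 : C ((Pi.single 3 1 : Fin 4 → K) 3) + X 3 = (1 + X 3 : MvPolynomial (Fin 4) K) := by
      rw [Pi.single_eq_same, map_one]
    have h4 : ((fun i : Fin 4 => C ((Pi.single 3 1 : Fin 4 → K) i) + X i) ∘ Fin.castSucc) =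
        X ∘ Fin.castSucc := by
      ext1 i
      have h3 : i.castSucc ≠ (3 : Fin 4) := (Fin.castSucc_lt_last i).ne
      simp [h3]
    rw [map_mul, map_pow, aeval_X, aeval_rename, h3, h4,
      ← aeval_rename, aeval_X_left_apply]
  -- Restriction to the plane `z = 0` isolates the coefficients of the powers of `z`.
  let L : Fin 4 → MvPolynomial (Fin 3) K := Fin.snoc (α := fun _ => MvPolynomial (Fin 3) K) X 0
  have hL3 : L 3 = 0 := Fin.snoc_last (α := fun _ => MvPolynomial (Fin 3) K) 0 X
  have hLi (i : Fin 3) : L i.castSucc = X i :=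
    Fin.snoc_castSucc (α := fun _ => MvPolynomial (Fin 3) K) 0 X i
  have hL : ∀ i, (L i).IsHomogeneous 1 := by
    intro i
    induction i using Fin.lastCases with
    | last =>
      exact hL3 ▸ isHomogeneous_zero _ _ _
    | cast i =>
      exact hLi i ▸ isHomogeneous_X K i
  have hTr : aeval L T = ∑ k ∈ Finset.range 5, c k := by
    rw [hTc, map_sum]
    refine Finset.sum_congr rfl fun k _ => ?_
    have h4 : L ∘ Fin.castSucc = X := funext hLi
    rw [map_mul, map_pow, map_add, map_one, aeval_X, hL3, add_zero, one_pow, one_mul, aeval_rename,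
      h4, aeval_X_left_apply]
  have hcomp : ∀ k ≤ 4, homogeneousComponent (4 - k) T = 0 → c k = 0 := fun k hk h => by
    have h1 := homogeneousComponent_aeval hL T (4 - k)
    rw [h, map_zero, hTr, map_sum, Finset.sum_eq_single_of_mem k (by simpa using by omega)] at h1
    · rwa [homogeneousComponent_of_mem (hc k hk), if_pos rfl] at h1
    · intro j hj hjk
      have hj' : j ≤ 4 := by
        have := Finset.mem_range.mp hj
        omega
      rw [homogeneousComponent_of_mem (hc j hj'), if_neg (by omega)]
  have hc4 : c 4 = 0 := hcomp 4 le_rfl (hT0 0 (by norm_num))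
  have hc3 : c 3 = 0 := hcomp 3 (by norm_num) (hT0 1 (by norm_num))
  refine ⟨A, c 2, c 1, c 0, ⟨?_, hc 2 (by norm_num), hc 1 (by norm_num), hc 0 (by norm_num), ?_⟩,
    fun hc2 => hT2 ?_⟩
  · rw [hA, P.submodule_eq]
  · rw [hFc]
    simp [Finset.sum_range_succ, hc3, hc4]
    ring
  · have h1 : (rename Fin.castSucc (c 1) : MvPolynomial (Fin 4) K).IsHomogeneous 3 :=
      (hc 1 (by norm_num)).rename_isHomogeneous
    have h0 : (rename Fin.castSucc (c 0) : MvPolynomial (Fin 4) K).IsHomogeneous 4 :=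
      (hc 0 (by norm_num)).rename_isHomogeneous
    have hT' : T = rename Fin.castSucc (c 1) + (X 3 * rename Fin.castSucc (c 1) +
        rename Fin.castSucc (c 0)) := by
      rw [hTc]
      simp [Finset.sum_range_succ, hc2, hc3, hc4]
      ring
    have h4 := ((isHomogeneous_X K (3 : Fin 4)).mul h1).add h0
    rw [hT', map_add, homogeneousComponent_of_mem h1, homogeneousComponent_of_mem h4]
    simp

/-- If the projection with centre `P` is separable, the equation of the surface is not invariant
under translation along the cone over `P`: otherwise the equation of the generic fibre has
derivative zero, so that it is constant, and the Taylor expansion of `F` at `P` is `F` itself,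
which has no terms of degree `2`. -/
lemma sum_mul_pderiv_ne_zero {F : MvPolynomial (Fin 4) K} (hF : F.IsHomogeneous 4)
    {P : Projectivization K (Fin 4 → K)} (hP : HasMultiplicity F P 2)
    (hsep : SeparableProjection F P) : ∑ i, C (P.rep i) * pderiv i F ≠ 0 := by
  intro h
  obtain ⟨p, hp⟩ : ∃ p, p = P.rep := ⟨_, rfl⟩
  rw [← hp] at h
  let L := FractionRing (MvPolynomial (Fin 4) K)
  have hder : Polynomial.derivative (genericFibre F p) = 0 := by
    have h1 := derivation_aeval ((Polynomial.derivative' (R := L)).restrictScalars K)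
      (fun i => Polynomial.C (algebraMap (MvPolynomial (Fin 4) K) L (X i)) +
        Polynomial.C (algebraMap K L (p i)) * Polynomial.X) F
    have h2 := congr_arg (aeval (fun i =>
      Polynomial.C (algebraMap (MvPolynomial (Fin 4) K) L (X i)) +
        Polynomial.C (algebraMap K L (p i)) * Polynomial.X)) h
    rw [map_zero, map_sum] at h2
    refine Eq.trans h1 (Eq.trans (Finset.sum_congr rfl fun i _ => ?_) h2)
    rw [map_mul, mul_comm]
    congr 1
    change Polynomial.derivative _ = _
    rw [Polynomial.derivative_add, Polynomial.derivative_C, Polynomial.derivative_C_mul,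
      Polynomial.derivative_X, algHom_C]
    simp
  have hunit : IsUnit (genericFibre F p) := by
    have h1 : IsCoprime (genericFibre F p) (Polynomial.derivative (genericFibre F p)) := hp ▸ hsep
    rwa [hder, isCoprime_zero_right] at h1
  obtain ⟨c, -, hc⟩ := Polynomial.isUnit_iff.mp hunit
  have heval : ∀ t : K, (genericFibre F p).eval (algebraMap K L t) =
      algebraMap (MvPolynomial (Fin 4) K) L (aeval (fun i => X i + C (p i) * C t) F) := fun t => by
    let ε : Polynomial L →ₐ[K] L := (Polynomial.aeval (algebraMap K L t)).restrictScalars K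
    have h1 : ε.comp (aeval fun i =>
        Polynomial.C (algebraMap (MvPolynomial (Fin 4) K) L (X i)) +
          Polynomial.C (algebraMap K L (p i)) * Polynomial.X) =
        (IsScalarTower.toAlgHom K (MvPolynomial (Fin 4) K) L).comp
          (aeval fun i => X i + C (p i) * C t) := by
      ext i
      simp only [AlgHom.comp_apply, aeval_X, map_add, map_mul, IsScalarTower.coe_toAlgHom']
      simp only [← algebraMap_eq, ← IsScalarTower.algebraMap_apply]
      simp [ε]
    have h2 := DFunLike.congr_fun h1 F
    rw [genericFibre]
    simpa [ε, Polynomial.aeval_def, Polynomial.eval₂_eq_eval_map] using h2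
  have h01 : translate F p = F := by
    have h1 : algebraMap (MvPolynomial (Fin 4) K) L (aeval (fun i => X i + C (p i) * C 1) F) =
        algebraMap (MvPolynomial (Fin 4) K) L (aeval (fun i => X i + C (p i) * C 0) F) := by
      rw [← heval, ← heval, ← hc]
      simp
    have h2 := IsFractionRing.injective (MvPolynomial (Fin 4) K) L h1
    simp only [map_one, mul_one, map_zero, mul_zero, add_zero, aeval_X_left_apply] at h2
    rw [translate]
    simp only [add_comm (C _)]
    exact h2
  apply hP.2
  rw [← hp, h01, homogeneousComponent_of_mem hF, if_neg (by norm_num)]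

variable [CharP K 2]

lemma IsTaylorDevelopment.ne_zero {F : MvPolynomial (Fin 4) K} (hF : F.IsHomogeneous 4)
    {P : Projectivization K (Fin 4 → K)} (hP : HasMultiplicity F P 2)
    (hsep : SeparableProjection F P) {A : GL (Fin 4) K} {Q G B : MvPolynomial (Fin 3) K}
    (h : IsTaylorDevelopment F P A Q G B) : G ≠ 0 := by
  rintro rfl
  have h1 := pderiv_last_quarticForm Q 0 B
  have heq : changeCoordinates A F = quarticForm Q 0 B := h.equation
  rw [← heq, pderiv_changeCoordinates, map_zero] at h1
  have h2 : changeCoordinates A (∑ i, C ((A : Matrix (Fin 4) (Fin 4) K) i 3) * pderiv i F) = 0 := by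
    rw [← h1, changeCoordinates, map_sum]
    refine Finset.sum_congr rfl fun i _ => ?_
    rw [map_mul, algHom_C]
    rfl
  have h3 := changeCoordinates_eq_zero h2
  have hc := h.centre
  rw [P.submodule_eq] at hc
  obtain ⟨a, ha⟩ := Submodule.mem_span_singleton.mp
    (hc ▸ Submodule.mem_span_singleton_self P.rep : P.rep ∈ Submodule.span K
      {(A : Matrix (Fin 4) (Fin 4) K).mulVec (Pi.single 3 1)})
  refine sum_mul_pderiv_ne_zero hF hP hsep ?_
  rw [← ha]
  have h4 := congr_arg (fun f => C a * f) h3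
  simp only [Finset.mul_sum, mul_zero] at h4
  rw [← h4]
  refine Finset.sum_congr rfl fun i _ => ?_
  simp [mul_assoc]

variable [IsAlgClosed K]

/-- If the tangent cone at `P` is a double plane, a normal quartic surface has at most `16` singular
points. -/
lemma IsTaylorDevelopment.ncard_le_of_sq {F : MvPolynomial (Fin 4) K} (hF : F.IsHomogeneous 4)
    (hfin : (singularPoints F).Finite)
    {P : Projectivization K (Fin 4 → K)} (hP : HasMultiplicity F P 2)
    (hsep : SeparableProjection F P) {A : GL (Fin 4) K} {ℓ G B : MvPolynomial (Fin 3) K}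
    (hℓ : ℓ.IsHomogeneous 1) (hℓ0 : ℓ ≠ 0)
    (h : IsTaylorDevelopment F P A (ℓ ^ 2) G B) : (singularPoints F).ncard ≤ 16 := by
  have heq : changeCoordinates A F = quarticForm (ℓ ^ 2) G B := h.equation
  have hG0 := h.ne_zero hF hP hsep
  have hfin' : (singularPoints (quarticForm (ℓ ^ 2) G B)).Finite := by
    rw [← heq, singularPoints_changeCoordinates A hF]
    exact hfin.preimage (MulAction.injective A).injOn
  rw [← ncard_singularPoints_changeCoordinates A hF, heq]
  have h1 := ncard_singularPoints_le h.homogeneous_Q h.homogeneous_G h.homogeneous_B hfin'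
  have h2 := sum_ncard_le_of_sq hℓ h.homogeneous_G h.homogeneous_B hℓ0 hG0
    (finite_image_singularOver h.homogeneous_Q h.homogeneous_G h.homogeneous_B hfin')
    (finite_singularOver h.homogeneous_Q h.homogeneous_G h.homogeneous_B hfin')
  omega

lemma IsTaylorDevelopment.ncard_le {F : MvPolynomial (Fin 4) K} (hF : F.IsHomogeneous 4)
    (hfin : (singularPoints F).Finite)
    {P : Projectivization K (Fin 4 → K)} (hP : HasMultiplicity F P 2)
    (hsep : SeparableProjection F P) {A : GL (Fin 4) K} {Q G B : MvPolynomial (Fin 3) K}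
    (hQ0 : Q ≠ 0) (h : IsTaylorDevelopment F P A Q G B) : (singularPoints F).ncard ≤ 24 := by
  by_cases hsq : ∃ ℓ, Q = ℓ ^ 2
  · obtain ⟨ℓ, rfl⟩ := hsq
    have hℓ0 : ℓ ≠ 0 := fun h0 => hQ0 (by rw [h0]; simp)
    have hℓ : ℓ.IsHomogeneous 1 := by
      have h2 := h.homogeneous_Q
      rw [sq] at h2 hQ0
      obtain ⟨a, b, hab, ha, hb⟩ := isHomogeneous_of_mul h2 hQ0
      have := ha.inj_right hb hℓ0
      obtain rfl : a = 1 := by omega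
      exact ha
    exact (h.ncard_le_of_sq hF hfin hP hsep hℓ hℓ0).trans (by norm_num)
  have heq : changeCoordinates A F = quarticForm Q G B := h.equation
  have hG0 := h.ne_zero hF hP hsep
  have hfin' : (singularPoints (quarticForm Q G B)).Finite := by
    rw [← heq, singularPoints_changeCoordinates A hF]
    exact hfin.preimage (MulAction.injective A).injOn
  rw [← ncard_singularPoints_changeCoordinates A hF, heq]
  have h1 := ncard_singularPoints_le h.homogeneous_Q h.homogeneous_G h.homogeneous_B hfin'
  have h2 := sum_ncard_le_of_not_sq h.homogeneous_Q h.homogeneous_G h.homogeneous_B hQ0 hG0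
    (finite_image_singularOver h.homogeneous_Q h.homogeneous_G h.homogeneous_B hfin')
    (finite_singularOver h.homogeneous_Q h.homogeneous_G h.homogeneous_B hfin') hsq
  omega

end Development

end QuarticSurface

theorem proposition2p5 {K : Type*} [Field K] [IsAlgClosed K] [CharP K 2]
    (F : MvPolynomial (Fin 4) K) (hF : F.IsHomogeneous 4)
    (hnormal : (QuarticSurface.singularPoints F).Finite)
    (P : Projectivization K (Fin 4 → K))
    (hP : QuarticSurface.HasMultiplicity F P 2)
    (hsep : QuarticSurface.SeparableProjection F P) :
    (QuarticSurface.singularPoints F).ncard ≤ 25 ∧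
    ∀ (A : GL (Fin 4) K) (G B : MvPolynomial (Fin 3) K),
      QuarticSurface.IsTaylorDevelopment F P A (MvPolynomial.X 0 ^ 2) G B →
      (MvPolynomial.X 0 ∣ G → (QuarticSurface.singularPoints F).ncard ≤ 17) ∧
      ((∃ l₁ l₂ n₁ n₂ : K,
          G = MvPolynomial.X 0 ^ 2 *
                (MvPolynomial.C l₁ * MvPolynomial.X 0 + MvPolynomial.C l₂ * MvPolynomial.X 1) +
              MvPolynomial.X 1 * MvPolynomial.X 2 *
                (MvPolynomial.C n₁ * MvPolynomial.X 0 + MvPolynomial.C n₂ * MvPolynomial.X 1)) →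
        (QuarticSurface.singularPoints F).ncard ≤ 19) ∧
      ((∃ l₁ l₂ l₃ m₂ m₃ : K,
          G = MvPolynomial.X 0 ^ 2 *
                (MvPolynomial.C l₁ * MvPolynomial.X 0 + MvPolynomial.C l₂ * MvPolynomial.X 1 +
                  MvPolynomial.C l₃ * MvPolynomial.X 2) +
              MvPolynomial.X 0 * MvPolynomial.X 1 *
                (MvPolynomial.C m₂ * MvPolynomial.X 1 + MvPolynomial.C m₃ * MvPolynomial.X 2) +
              MvPolynomial.X 1 ^ 3) →
        (QuarticSurface.singularPoints F).ncard ≤ 19) := by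
  refine ⟨?_, fun A G B h => ?_⟩
  · obtain ⟨A, Q, G, B, h, hQ⟩ := QuarticSurface.exists_taylorDevelopment hF hP
    exact (h.ncard_le hF hnormal hP hsep hQ).trans (by norm_num)
  · have h16 := h.ncard_le_of_sq hF hnormal hP hsep (MvPolynomial.isHomogeneous_X K 0)
      (MvPolynomial.X_ne_zero 0)
    exact ⟨fun _ => h16.trans (by norm_num), fun _ => h16.trans (by norm_num),
      fun _ => h16.trans (by norm_num)⟩
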